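/- **Setting.** Let $\mathbb X\subseteq\mathbb R$ be closed and unbounded above, with jump operators $\sigma(t)=\inf\{s\in\mathbb X:s>t\}$, $\rho(t)=\sup\{s\in\mathbb X:s<t\}$ (and $\rho(\min\mathbb X)=\min\mathbb X$ if $\mathbb X$ has a minimum) and graininess $\mu(t)=\sigma(t)-t$. Let $t_0\in\mathbb X$, write $[t_0,\infty)_{\mathbb X}=[t_0,\infty)\cap\mathbb X$, and assume that $\mathbb X$ is Sturmian: $\sigma(\rho(t))=\rho(\sigma(t))=t$ for $t\in[t_0,\infty)_{\mathbb X}$. Delta derivatives and delta integrals are taken on $[t_0,\infty)_{\mathbb X}$. Let $n\in\mathbb N$, $J=\begin{pmatrix}0&-I_n\\ I_n&0\end{pmatrix}$, and $$A(t)=\begin{pmatrix}A_1(t)&0\\0&A_2(t)\end{pmatrix}\ge 0,\qquad B(t)=\begin{pmatrix}B_1(t)&B_2(t)\\B_3(t)&B_4(t)\end{pmatrix},\qquad t\in[t_0,\infty)_{\mathbb X},$$ with rd-continuous blocks $A_j(t),B_k(t)\in\mathbb C^{n\times n}$ such that $A(t)$ is Hermitian and $I_n+\mu(t)B_2(t)$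 and $I_n+\mu(t)B_3(t)$ are invertible for all $t\in[t_0,\infty)_{\mathbb X}$. For $y=(y_1,y_2)^{T}$ with $n$-row blocks $y_1$ on $[t_0,\infty)_{\mathbb X}$ and $y_2$ on $[\rho(t_0),\infty)_{\mathbb X}$, put $\widehat y(t)=(y_1(t),y_2(\rho(t)))^{T}$. For $\lambda\in\mathbb C$ let $Y(\cdot,\lambda)=(\theta|\phi)$ and $Z(\cdot,\lambda)=(\eta|\chi)$ (with $2n\times n$ blocks) be the solutions of $$J\widehat Y^{\Delta}=(\lambda A+B)Y,\quad \widehat Y(t_0)=J,\qquad\qquad J\widehat Z^{\Delta}=(\overline\lambda A+B^*)Z,\quad \widehat Z(t_0)=J$$ on $[t_0,\infty)_{\mathbb X}$. Write $\operatorname{Re}M=\frac12(M+M^*)$. Let $\lambda_0\in\mathbb C$, let $\mathscr U\in\mathbb C^{n\times n}$ be invertible, $\mathscr U_{2n}=\operatorname{diag}(\mathscr U,-\mathscr U^*)$, and put $$W(t,\lambda)=\operatorname{Re}[\mathscr U_{2n}(\lambda A(t)+B(t))],\qquad \widetilde A(t)=\mathscr U_{2n}A(t)\mathscr U_{2n}^*,$$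 $$\Lambda=\Lambda(\lambda_0,\mathscr U_{2n})=\{\lambda\in\mathbb C:\ \exists\,\delta>0\ \ \forall t\in[t_0,\infty)_{\mathbb X}\ \ \operatorname{Re}[(\lambda-\lambda_0)\mathscr U_{2n}A(t)]\ge\delta\widetilde A(t)\}.$$ Assume: 1. (admissibility) $W(t,\lambda_0)\ge0$ for all $t\in[t_0,\infty)_{\mathbb X}$; 2. (definiteness) for $\lambda\in\Lambda$ and $v\in\mathbb C^n$, if $W(t,\lambda)\phi(t,\lambda)v=0$ for all $t\in[t_0,\infty)_{\mathbb X}$, then $v=0$; 3. $\widetilde A\asymp A$, that is, there are constants $c,C>0$ with $cA(t)\le\widetilde A(t)\le CA(t)$ for all $t\in[t_0,\infty)_{\mathbb X}$. For $\lambda\in\Lambda$ and $t\in[t_0,\infty)_{\mathbb X}$ define the Weyl–Sims sets $$D(t,\lambda)=\{l\in\mathbb C^{n\times n}:(\widehat\theta+\widehat\phi\,l)^*(t,\lambda)\,\mathscr U_{2n}J\,(\widehat\theta+\widehat\phi\,l)(t,\lambda)\le0\},\qquad D(\infty,\lambda)=\bigcap_{t\in[t_0,\infty)_{\mathbb X}}D(t,\lambda).$$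 **Theorem (M-function).** Let $\xi\in\Lambda$ and $M_0\in D(\infty,\xi)$ be fixed. Then there is a function $M:\Lambda\to\mathbb C^{n\times n}$ such that $M(\xi)=M_0$ and, for every $\lambda\in\Lambda$, $M(\lambda)\in D(\infty,\lambda)$ and, with the Weyl solutions $\psi(t,\lambda)=\theta(t,\lambda)+\phi(t,\lambda)M(\lambda)$ and $\zeta(t,\lambda)=\eta(t,\lambda)+\chi(t,\lambda)M(\lambda)^*$, $$M(\lambda)-M_0=(\lambda-\xi)\int_{t_0}^{\infty}\zeta^*(t,\xi)A(t)\psi(t,\lambda)\,\Delta t=(\lambda-\xi)\int_{t_0}^{\infty}\zeta^*(t,\lambda)A(t)\psi(t,\xi)\,\Delta t,$$ where both delta integrals converge absolutely, and $$\lim_{t\to\infty}\widehat\zeta^{\,*}(t,\xi)J\widehat\psi(t,\lambda)=\lim_{t\to\infty}\widehat\zeta^{\,*}(t,\lambda)J\widehat\psi(t,\xi)=0\qquad(t\in[t_0,\infty)_{\mathbb X}).$$ -/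

import Mathlib

open MeasureTheory Filter Topology
open scoped Matrix ComplexConjugate ComplexOrder

namespace WeylSims

/-! ### Time scales -/

/-- Forward jump `σ(t) = inf {s ∈ X : s > t}` (only used for sets `X` that are unbounded above). -/
noncomputable def fwd (X : Set ℝ) (t : ℝ) : ℝ := sInf {s | s ∈ X ∧ t < s}

open Classical in
/-- Backward jump `ρ(t) = sup {s ∈ X : s < t}`, with the usual convention `ρ(min X) = min X`. -/
noncomputable def bwd (X : Set ℝ) (t : ℝ) : ℝ :=
  if ∃ s ∈ X, s < t then sSup {s | s ∈ X ∧ s < t} else t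

/-- The half-line `[t₀, ∞)` of the time scale `X`. -/
def ray (X : Set ℝ) (t₀ : ℝ) : Set ℝ := {t | t ∈ X ∧ t₀ ≤ t}

/-- `f`, regarded as a function on `[t₀, ∞)` in `X`, is rd-continuous: continuous at right-dense
points, with a finite left limit at left-dense points. -/
def RdContinuous {E : Type*} [TopologicalSpace E] (X : Set ℝ) (t₀ : ℝ) (f : ℝ → E) : Prop :=
  ∀ t ∈ ray X t₀,
    (fwd X t = t → ContinuousWithinAt f (ray X t₀) t) ∧
    (bwd X t = t → ∃ l : E, Tendsto f (𝓝[ray X t₀ ∩ Set.Iio t] t) (𝓝 l))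

/-- `f`, regarded as a function on `[t₀, ∞)` in `X`, has delta derivative `d` at `t`:
`(f (σ t) - f s) / (σ t - s) → d` as `s → t` in the time scale, `s ≠ σ t`. -/
def HasDeltaDeriv {E : Type*} [TopologicalSpace E] [AddCommGroup E] [Module ℝ E]
    (X : Set ℝ) (t₀ : ℝ) (f : ℝ → E) (d : E) (t : ℝ) : Prop :=
  Tendsto (fun s => (fwd X t - s)⁻¹ • (f (fwd X t) - f s))
    (𝓝[ray X t₀ \ {fwd X t}] t) (𝓝 d)

/-- `s ↦ max {t ∈ [t₀, ∞) ∩ X : t ≤ s}`, for `s ≥ t₀`. -/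
noncomputable def retract (X : Set ℝ) (t₀ : ℝ) (s : ℝ) : ℝ := sSup {t | t ∈ ray X t₀ ∧ t ≤ s}

/-- The Lebesgue delta measure on `[t₀, ∞)` in `X`, as the image of Lebesgue measure on `[t₀, ∞)`
under `retract`: it lives on the time scale and gives `[a, b) ∩ X` the mass `b - a`
(`deltaMeasure_Ico` and `deltaMeasure_compl` below). Delta integrals are integrals against it. -/
noncomputable def deltaMeasure (X : Set ℝ) (t₀ : ℝ) : Measure ℝ :=
  (volume.restrict (Set.Ici t₀)).map (retract X t₀)

theorem retract_le {X : Set ℝ} {t₀ s : ℝ} (h₀ : t₀ ∈ X) (hs : t₀ ≤ s) : retract X t₀ s ≤ s :=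
  csSup_le ⟨t₀, ⟨h₀, le_refl t₀⟩, hs⟩ (fun _ h => h.2)

theorem le_retract {X : Set ℝ} {t₀ s a : ℝ} (ha : a ∈ ray X t₀) (has : a ≤ s) :
    a ≤ retract X t₀ s :=
  le_csSup ⟨s, fun _ h => h.2⟩ ⟨ha, has⟩

theorem aemeasurable_retract {X : Set ℝ} {t₀ : ℝ} (h₀ : t₀ ∈ X) :
    AEMeasurable (retract X t₀) (volume.restrict (Set.Ici t₀)) := by
  refine aemeasurable_restrict_of_monotoneOn measurableSet_Ici ?_
  intro a ha b _ hab
  exact csSup_le ⟨t₀, ⟨h₀, le_refl t₀⟩, ha⟩ (fun c hc => le_retract hc.1 (hc.2.trans hab))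

theorem deltaMeasure_Ico {X : Set ℝ} {t₀ a b : ℝ} (h₀ : t₀ ∈ X)
    (ha : a ∈ ray X t₀) (hb : b ∈ ray X t₀) :
    deltaMeasure X t₀ (Set.Ico a b) = ENNReal.ofReal (b - a) := by
  rw [deltaMeasure, Measure.map_apply_of_aemeasurable (aemeasurable_retract h₀) measurableSet_Ico,
    Measure.restrict_apply' measurableSet_Ici]
  have : retract X t₀ ⁻¹' Set.Ico a b ∩ Set.Ici t₀ = Set.Ico a b := by
    ext s
    constructor
    · rintro ⟨⟨h1, h2⟩, h3⟩
      refine ⟨h1.trans (retract_le h₀ h3), ?_⟩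
      by_contra! h
      exact absurd (le_retract hb h) (not_le.2 h2)
    · rintro ⟨h1, h2⟩
      have h3 : t₀ ≤ s := ha.2.trans h1
      exact ⟨⟨le_retract ha h1, (retract_le h₀ h3).trans_lt h2⟩, h3⟩
  rw [this, Real.volume_Ico]

theorem deltaMeasure_compl {X : Set ℝ} {t₀ : ℝ} (hX : IsClosed X) (h₀ : t₀ ∈ X) :
    deltaMeasure X t₀ (ray X t₀)ᶜ = 0 := by
  have hc : IsClosed (ray X t₀) := hX.inter isClosed_Ici
  rw [deltaMeasure, Measure.map_apply_of_aemeasurable (aemeasurable_retract h₀)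
    hc.measurableSet.compl, Measure.restrict_apply' measurableSet_Ici]
  convert measure_empty (μ := (volume : Measure ℝ))
  ext s
  simp only [Set.mem_inter_iff, Set.mem_preimage, Set.mem_compl_iff, Set.mem_empty_iff_false,
    iff_false, not_and, Set.mem_Ici]
  intro h hs
  refine h ?_
  have hcs : IsClosed (ray X t₀ ∩ Set.Iic s) := hc.inter isClosed_Iic
  exact (hcs.csSup_mem ⟨t₀, ⟨h₀, le_refl t₀⟩, hs⟩ ⟨s, fun _ h => h.2⟩).1

/-! ### Matrices -/

/-- Complex `2n × 2n` matrices in `n × n` blocks. -/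
abbrev Mat2 (n : ℕ) := Matrix (Fin n ⊕ Fin n) (Fin n ⊕ Fin n) ℂ

/-- Complex `2n × n` matrices. -/
abbrev Col2 (n : ℕ) := Matrix (Fin n ⊕ Fin n) (Fin n) ℂ

/-- `J = (0, -I; I, 0)`. -/
def J (n : ℕ) : Mat2 n := Matrix.fromBlocks 0 (-1) 1 0

/-- Real part `(M + M*) / 2` of a square matrix. -/
noncomputable def rePart {ι : Type*} (M : Matrix ι ι ℂ) : Matrix ι ι ℂ := (1 / 2 : ℂ) • (M + Mᴴ)

/-- `U₂ₙ = diag (U, -U*)`. -/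
def rot {n : ℕ} (U : Matrix (Fin n) (Fin n) ℂ) : Mat2 n := Matrix.fromBlocks U 0 0 (-Uᴴ)

/-! ### The Hamiltonian system -/

/-- The data of a complex Hamiltonian system `J ŷ^Δ = (λ A + B) y` on a Sturmian time scale `X`,
started at `t₀ ∈ X`, with `A = diag (A₁, A₂) ≥ 0` and `B = (B₁, B₂; B₃, B₄)`. -/
structure HamiltonianSystem (n : ℕ) where
  X : Set ℝ
  t₀ : ℝ
  A₁ : ℝ → Matrix (Fin n) (Fin n) ℂ
  A₂ : ℝ → Matrix (Fin n) (Fin n) ℂ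
  B₁ : ℝ → Matrix (Fin n) (Fin n) ℂ
  B₂ : ℝ → Matrix (Fin n) (Fin n) ℂ
  B₃ : ℝ → Matrix (Fin n) (Fin n) ℂ
  B₄ : ℝ → Matrix (Fin n) (Fin n) ℂ
  isClosed : IsClosed X
  unbounded : ¬ BddAbove X
  t₀_mem : t₀ ∈ X
  sturmian : ∀ t ∈ ray X t₀, fwd X (bwd X t) = t ∧ bwd X (fwd X t) = t
  rd_A₁ : RdContinuous X t₀ A₁
  rd_A₂ : RdContinuous X t₀ A₂
  rd_B₁ : RdContinuous X t₀ B₁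
  rd_B₂ : RdContinuous X t₀ B₂
  rd_B₃ : RdContinuous X t₀ B₃
  rd_B₄ : RdContinuous X t₀ B₄
  nonneg : ∀ t ∈ ray X t₀, (Matrix.fromBlocks (A₁ t) 0 0 (A₂ t)).PosSemidef
  regressive₂ : ∀ t ∈ ray X t₀, IsUnit (1 + (fwd X t - t) • B₂ t)
  regressive₃ : ∀ t ∈ ray X t₀, IsUnit (1 + (fwd X t - t) • B₃ t)

namespace HamiltonianSystem

variable {n : ℕ} (S : HamiltonianSystem n)

/-- The interval `[t₀, ∞)` of the time scale. -/
def T : Set ℝ := ray S.X S.t₀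

/-- `A = diag (A₁, A₂)`. -/
def A (t : ℝ) : Mat2 n := Matrix.fromBlocks (S.A₁ t) 0 0 (S.A₂ t)

/-- `B = (B₁, B₂; B₃, B₄)`. -/
def B (t : ℝ) : Mat2 n := Matrix.fromBlocks (S.B₁ t) (S.B₂ t) (S.B₃ t) (S.B₄ t)

/-- The filter `t → ∞` in the time scale. -/
def toInfty : Filter ℝ := atTop ⊓ 𝓟 S.T

/-- The partial left shift `ŷ(t) = (y₁(t); y₂(ρ(t)))`, applied to each column. -/
noncomputable def hat {m : Type*} (y : ℝ → Matrix (Fin n ⊕ Fin n) m ℂ) (t : ℝ) :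
    Matrix (Fin n ⊕ Fin n) m ℂ :=
  Matrix.fromRows (y t).toRows₁ (y (bwd S.X t)).toRows₂

/-- `y` solves `J ŷ^Δ(t) = C(t) y(t)` for all `t ∈ [t₀, ∞)` in the time scale. -/
def IsSolution {m : Type*} (C : ℝ → Mat2 n) (y : ℝ → Matrix (Fin n ⊕ Fin n) m ℂ) : Prop :=
  ∀ t ∈ S.T, ∃ d, HasDeltaDeriv S.X S.t₀ (S.hat y) d t ∧ J n * d = C t * y t

/-- The solution `Y` of `J Ŷ^Δ = C Y`, `Ŷ(t₀) = J`, which exists and whose values on `[t₀, ∞)`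
in the time scale are unique for the coefficients `C` used below. -/
noncomputable def fundamental (C : ℝ → Mat2 n) : ℝ → Mat2 n :=
  Classical.epsilon fun Y => S.IsSolution C Y ∧ S.hat Y S.t₀ = J n

/-- `Y(·, λ) = (θ | φ)`, for the system `J ŷ^Δ = (λ A + B) y`. -/
noncomputable def Y (z : ℂ) : ℝ → Mat2 n := S.fundamental fun t => z • S.A t + S.B t

/-- `Z(·, λ) = (η | χ)`, for the adjoint system `J ẑ^Δ = (λ̄ A + B*) z`. -/
noncomputable def Z (z : ℂ) : ℝ → Mat2 n :=
  S.fundamental fun t => (conj z) • S.A t + (S.B t)ᴴ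

/-- The first `n` columns of `Y`. -/
noncomputable def θ (z : ℂ) (t : ℝ) : Col2 n := (S.Y z t).toCols₁
/-- The last `n` columns of `Y`. -/
noncomputable def φ (z : ℂ) (t : ℝ) : Col2 n := (S.Y z t).toCols₂
/-- The first `n` columns of `Z`. -/
noncomputable def η (z : ℂ) (t : ℝ) : Col2 n := (S.Z z t).toCols₁
/-- The last `n` columns of `Z`. -/
noncomputable def χ (z : ℂ) (t : ℝ) : Col2 n := (S.Z z t).toCols₂

/-- `ψ = θ + φ l`. -/
noncomputable def ψ (z : ℂ) (l : Matrix (Fin n) (Fin n) ℂ) (t : ℝ) : Col2 n :=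
  S.θ z t + S.φ z t * l

/-- `ζ = η + χ l*`. -/
noncomputable def ζ (z : ℂ) (l : Matrix (Fin n) (Fin n) ℂ) (t : ℝ) : Col2 n :=
  S.η z t + S.χ z t * lᴴ

/-- `W(t, λ) = Re [U₂ₙ (λ A(t) + B(t))]`. -/
noncomputable def W (U : Matrix (Fin n) (Fin n) ℂ) (z : ℂ) (t : ℝ) : Mat2 n :=
  rePart (rot U * (z • S.A t + S.B t))

/-- `Ã(t) = U₂ₙ A(t) U₂ₙ*`. -/
def Atilde (U : Matrix (Fin n) (Fin n) ℂ) (t : ℝ) : Mat2 n := rot U * S.A t * (rot U)ᴴ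

/-- `(λ₀, U₂ₙ)` is an admissible pair: `U` is invertible and `W(t, λ₀) ≥ 0` on `[t₀, ∞)`. -/
def Admissible (z₀ : ℂ) (U : Matrix (Fin n) (Fin n) ℂ) : Prop :=
  IsUnit U ∧ ∀ t ∈ S.T, (S.W U z₀ t).PosSemidef

/-- `Λ(λ₀, U₂ₙ)`: those `λ` with `Re [(λ - λ₀) U₂ₙ A(t)] ≥ δ U₂ₙ A(t) U₂ₙ*` for some `δ > 0` and
all `t`. -/
def Λ (z₀ : ℂ) (U : Matrix (Fin n) (Fin n) ℂ) : Set ℂ :=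
  {z | ∃ δ : ℝ, 0 < δ ∧ ∀ t ∈ S.T,
    (rePart ((z - z₀) • (rot U * S.A t)) - δ • S.Atilde U t).PosSemidef}

/-- The definiteness condition: for `λ ∈ Λ(λ₀, U₂ₙ)`, if `W(t, λ) φ(t, λ) v = 0` for all `t`, then
`v = 0`. -/
def Definite (z₀ : ℂ) (U : Matrix (Fin n) (Fin n) ℂ) : Prop :=
  ∀ z ∈ S.Λ z₀ U, ∀ v : Fin n → ℂ, (∀ t ∈ S.T, (S.W U z t * S.φ z t) *ᵥ v = 0) → v = 0

/-- The Weyl-Sims set `D(t, λ)`: those `l` with `ψ̂(t)* U₂ₙ J ψ̂(t) ≤ 0`, where `ψ = θ + φ l`. -/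
def D (U : Matrix (Fin n) (Fin n) ℂ) (t : ℝ) (z : ℂ) : Set (Matrix (Fin n) (Fin n) ℂ) :=
  {l | (-((S.hat (S.ψ z l) t)ᴴ * (rot U * J n) * S.hat (S.ψ z l) t)).PosSemidef}

/-- The limit set `D(∞, λ)`. The sets `D(t, λ)` decrease as `t` increases, so that it does not
matter at which `t` the intersection starts. -/
def DInfty (U : Matrix (Fin n) (Fin n) ℂ) (z : ℂ) : Set (Matrix (Fin n) (Fin n) ℂ) :=
  ⋂ t ∈ S.T, S.D U t z

/-- `Ã ≍ A` on `[t₀, ∞)`: `c A(t) ≤ Ã(t) ≤ C A(t)` for some constants `c, C > 0` and all `t`. -/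
def Comparable (U : Matrix (Fin n) (Fin n) ℂ) : Prop :=
  ∃ c C : ℝ, 0 < c ∧ 0 < C ∧ ∀ t ∈ S.T,
    (S.Atilde U t - c • S.A t).PosSemidef ∧ (C • S.A t - S.Atilde U t).PosSemidef

/-- The delta integral of `F` over `[t₀, ∞)` in the time scale converges absolutely, with value
`I` (entry by entry). -/
def HasDeltaIntegral (F : ℝ → Matrix (Fin n) (Fin n) ℂ) (I : Matrix (Fin n) (Fin n) ℂ) : Prop :=
  ∀ i j, Integrable (fun t => F t i j) (deltaMeasure S.X S.t₀) ∧
    ∫ t, F t i j ∂(deltaMeasure S.X S.t₀) = I i j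

end HamiltonianSystem

end WeylSims

/-! For a solution `y` at `λ` and an adjoint solution `z` at `ξ`, the pairing `ẑ* J ŷ` has delta
derivative `(λ - ξ) z* A y`. On the Weyl solutions it starts at `M₀ - M(λ)`, or `M(λ) - M₀` with the
roles exchanged (`pairing_start`). Both integral formulas therefore follow once the pairings vanish
at infinity and the integrals converge (`hasDeltaIntegral_of_tendsto`). It remains to choose `M(λ)`
in `D(∞, λ)` so that both pairings tend to zero (`exists_mem_DInfty`).

Energy: `ŷ* U₂ₙ J ŷ` has delta derivative `2 y* Re[U₂ₙ(λA + B)] y`, which for `λ ∈ Λ` is at least a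
positive multiple of `y* A y`. The form is thus nondecreasing, the sets `D(t, λ)` shrink, and a
solution with nonpositive form at `τ` has its integral of `y* A y` up to `τ` bounded by its form at
`t₀` (`two_mul_integral_density_le`). The adjoint system obeys the same estimate with `U⁻¹` for `U`;
its Weyl solution `ζ` is nonpositive because it is `J`-orthogonal to the nonpositive `ψ`
(`posSemidef_dual`).

Choice: by definiteness the form of `φ` is positive definite from some `τ₀` on (`exists_posDef_φ`).
Hence `D(τ₀, λ)` is bounded, and for `τ ≥ τ₀` the range of `ψ̂(τ, ξ)`, being nonpositive, is also
the range of `(θ̂ + φ̂ l)(τ, λ)` for some `l` in `D(τ, λ)` (`exists_mem_D`). Since `ζ* J ψ` vanishes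
identically at equal parameters, both mixed pairings vanish at `τ`. Take `M(λ)` to be a limit of
these `l`. From `t` to `τ` a pairing changes by at most a constant times `κ` (tail of a convergent
integral) `+ κ⁻¹` (energy bounded in `τ`), for any `κ > 0`; passing to the limit in `τ`, fixing `κ`
large and then letting `t → ∞` gives the claim.

Delta integrals are handled as Lebesgue integrals of `f ∘ retract`. The Sturmian condition makes
each point dense or isolated and allows `y` to be rebuilt from `ŷ`, so that the system becomes an
ordinary linear delta equation for `ŷ`. -/

namespace WeylSims

/-! ### Calculus on Sturmian time scales -/

/-- `X` is a closed set, unbounded above, which is Sturmian on `[t₀, ∞)`. -/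
structure IsSturmian (X : Set ℝ) (t₀ : ℝ) : Prop where
  isClosed : IsClosed X
  unbounded : ¬ BddAbove X
  mem : t₀ ∈ X
  sturmian : ∀ t ∈ ray X t₀, fwd X (bwd X t) = t ∧ bwd X (fwd X t) = t

theorem fwd_le {X : Set ℝ} {t s : ℝ} (hs : s ∈ X) (hts : t < s) : fwd X t ≤ s :=
  csInf_le ⟨t, fun _ h => h.2.le⟩ ⟨hs, hts⟩

theorem le_bwd {X : Set ℝ} {t s : ℝ} (hs : s ∈ X) (hst : s < t) : s ≤ bwd X t := by
  rw [bwd, if_pos ⟨s, hs, hst⟩]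
  exact le_csSup ⟨t, fun _ h => h.2.le⟩ ⟨hs, hst⟩

theorem bwd_le {X : Set ℝ} (t : ℝ) : bwd X t ≤ t := by
  rw [bwd]
  split_ifs with h
  · obtain ⟨s, hs⟩ := h
    exact csSup_le ⟨s, hs⟩ fun _ h => h.2.le
  · exact le_rfl

theorem exists_mem_Ioo_of_bwd_eq {X : Set ℝ} {t a s : ℝ} (h : bwd X t = t) (ha : a < t)
    (hs : s ∈ X) (hst : s < t) : ∃ b ∈ X, a < b ∧ b < t := by
  rw [bwd, if_pos ⟨s, hs, hst⟩] at h
  obtain ⟨b, hb, hab⟩ := exists_lt_of_lt_csSup (s := {s | s ∈ X ∧ s < t}) ⟨s, hs, hst⟩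
    (by rw [h]; exact ha)
  exact ⟨b, hb.1, hab, hb.2⟩

theorem isClosed_ray {X : Set ℝ} (hX : IsClosed X) (t₀ : ℝ) : IsClosed (ray X t₀) :=
  hX.inter isClosed_Ici

theorem retract_of_mem {X : Set ℝ} {t₀ t : ℝ} (ht : t ∈ ray X t₀) : retract X t₀ t = t :=
  le_antisymm (csSup_le ⟨t, ht, le_rfl⟩ fun _ h => h.2) (le_retract ht le_rfl)

/-! ### Dense points, isolated points and the retraction -/

namespace IsSturmian

variable {X : Set ℝ} {t₀ : ℝ} (h : IsSturmian X t₀)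
include h

theorem exists_gt (t : ℝ) : ∃ s ∈ X, t < s := by
  by_contra! hc
  exact h.unbounded ⟨t, fun s hs => hc s hs⟩

theorem start_mem : t₀ ∈ ray X t₀ := ⟨h.mem, le_rfl⟩

theorem le_fwd (t : ℝ) : t ≤ fwd X t := by
  obtain ⟨s, hs⟩ := h.exists_gt t
  exact le_csInf ⟨s, hs⟩ fun _ h => h.2.le

theorem fwd_mem {t : ℝ} (ht : t ∈ ray X t₀) : fwd X t ∈ ray X t₀ := by
  obtain ⟨s, hs⟩ := h.exists_gt t
  refine ⟨?_, ht.2.trans (h.le_fwd t)⟩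
  have hm := csInf_mem_closure (s := {s | s ∈ X ∧ t < s}) ⟨s, hs⟩ ⟨t, fun _ h => h.2.le⟩
  exact h.isClosed.closure_subset_iff.2 (fun _ h => h.1) hm

theorem exists_mem_lt_of_fwd_eq {t b : ℝ} (ht : fwd X t = t) (hb : t < b) :
    ∃ s ∈ X, t < s ∧ s < b := by
  obtain ⟨s, hs⟩ := h.exists_gt t
  obtain ⟨s, hs, hsb⟩ := exists_lt_of_csInf_lt (s := {s | s ∈ X ∧ t < s}) ⟨s, hs⟩
    (show fwd X t < b by rwa [ht])
  exact ⟨s, hs.1, hs.2, hsb⟩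

theorem bwd_eq_of_fwd_eq {t : ℝ} (ht : t ∈ ray X t₀) (hd : fwd X t = t) : bwd X t = t := by
  simpa [hd] using (h.sturmian t ht).2

theorem bwd_lt {t : ℝ} (ht : t ∈ ray X t₀) (hs : t < fwd X t) : bwd X t < t := by
  refine lt_of_le_of_ne (bwd_le t) fun he => ?_
  have := (h.sturmian t ht).1
  rw [he] at this
  exact hs.ne' this

omit h in
theorem eq_of_mem_Ioo {t s : ℝ} (hs : s ∈ X)
    (hst : s ∈ Set.Ioo (bwd X t) (fwd X t)) : s = t := by
  rcases lt_trichotomy s t with h1 | h1 | h1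
  · exact absurd (le_bwd hs h1) (not_le.2 hst.1)
  · exact h1
  · exact absurd (fwd_le hs h1) (not_le.2 hst.2)

/-- A right-scattered point of a Sturmian scale is also left-scattered, hence isolated, and limits
at it are trivial. This is why the arguments below only distinguish right-dense from isolated
points. -/
theorem nhdsWithin_ray_of_lt {t : ℝ} (ht : t ∈ ray X t₀) (hs : t < fwd X t) :
    𝓝[ray X t₀] t = pure t := by
  refine le_antisymm ?_ (pure_le_nhdsWithin ht)
  rw [le_pure_iff]
  filter_upwards [self_mem_nhdsWithin,
    mem_nhdsWithin_of_mem_nhds (Ioo_mem_nhds (h.bwd_lt ht hs) hs)] with s h1 h2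
  exact eq_of_mem_Ioo h1.1 h2

theorem nhdsWithin_ray_diff_of_lt {t : ℝ} (ht : t ∈ ray X t₀) (hs : t < fwd X t) :
    𝓝[ray X t₀ \ {fwd X t}] t = pure t := by
  refine le_antisymm ?_ (pure_le_nhdsWithin ⟨ht, hs.ne⟩)
  rw [← h.nhdsWithin_ray_of_lt ht hs]
  exact nhdsWithin_mono _ Set.sdiff_subset

theorem neBot_nhdsWithin_diff {t : ℝ} (ht : t ∈ ray X t₀) :
    (𝓝[ray X t₀ \ {fwd X t}] t).NeBot := by
  rcases (h.le_fwd t).eq_or_lt with hd | hs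
  · rw [← hd, mem_closure_iff_nhdsWithin_neBot.symm, Metric.mem_closure_iff]
    intro ε hε
    obtain ⟨s, hs, h1, h2⟩ := h.exists_mem_lt_of_fwd_eq hd.symm (lt_add_of_pos_right t hε)
    refine ⟨s, ⟨⟨hs, ht.2.trans h1.le⟩, h1.ne'⟩, ?_⟩
    rw [dist_comm, Real.dist_eq, abs_of_pos (sub_pos.2 h1)]
    linarith
  · rw [h.nhdsWithin_ray_diff_of_lt ht hs]
    infer_instance

theorem continuousOn_of_rdContinuous {E : Type*} [TopologicalSpace E] {f : ℝ → E}
    (hf : RdContinuous X t₀ f) : ContinuousOn f (ray X t₀) := by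
  intro t ht
  rcases (h.le_fwd t).eq_or_lt with hd | hs
  · exact (hf t ht).1 hd.symm
  · rw [ContinuousWithinAt, h.nhdsWithin_ray_of_lt ht hs]
    exact tendsto_pure_nhds f t

theorem tendsto_fwd {t : ℝ} (hd : fwd X t = t) :
    Tendsto (fwd X) (𝓝[ray X t₀] t) (𝓝[ray X t₀] t) := by
  refine tendsto_nhdsWithin_iff.2 ⟨?_, eventually_nhdsWithin_of_forall fun s hs => h.fwd_mem hs⟩
  rw [tendsto_order]
  constructor
  · intro a ha
    filter_upwards [mem_nhdsWithin_of_mem_nhds (lt_mem_nhds ha)] with s hs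
    exact hs.trans_le (h.le_fwd s)
  · intro b hb
    obtain ⟨c, hc, h1, h2⟩ := h.exists_mem_lt_of_fwd_eq hd hb
    filter_upwards [mem_nhdsWithin_of_mem_nhds (gt_mem_nhds h1)] with s hs
    exact (fwd_le hc hs).trans_lt h2

theorem continuousOn_comp_fwd {E : Type*} [TopologicalSpace E] {f : ℝ → E}
    (hf : ContinuousOn f (ray X t₀)) : ContinuousOn (fun t => f (fwd X t)) (ray X t₀) := by
  intro t ht
  rcases (h.le_fwd t).eq_or_lt with hd | hs
  · have := (hf t ht).tendsto.comp (h.tendsto_fwd hd.symm)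
    rw [ContinuousWithinAt, ← hd]
    exact this
  · rw [ContinuousWithinAt, h.nhdsWithin_ray_of_lt ht hs]
    exact tendsto_pure_nhds _ t

theorem continuousOn_fwd : ContinuousOn (fwd X) (ray X t₀) :=
  h.continuousOn_comp_fwd continuousOn_id

theorem retract_mem {s : ℝ} (hs : t₀ ≤ s) : retract X t₀ s ∈ ray X t₀ := by
  have hcs : IsClosed (ray X t₀ ∩ Set.Iic s) := (isClosed_ray h.isClosed t₀).inter isClosed_Iic
  exact (hcs.csSup_mem ⟨t₀, h.start_mem, hs⟩ ⟨s, fun _ h => h.2⟩).1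

theorem retract_eq_of_mem_Ico {t s : ℝ} (ht : t ∈ ray X t₀) (hs : s ∈ Set.Ico t (fwd X t)) :
    retract X t₀ s = t := by
  refine le_antisymm ?_ (le_retract ht hs.1)
  by_contra! hlt
  exact absurd ((fwd_le (h.retract_mem (ht.2.trans hs.1)).1 hlt).trans
    (retract_le h.mem (ht.2.trans hs.1))) (not_le.2 hs.2)

/-- A right-dense `t > t₀` is left-dense as well, so points of the scale just below `t` keep the
retraction from dropping; from above it is squeezed by `retract s ≤ s`. -/
theorem tendsto_retract {t : ℝ} (ht : t ∈ ray X t₀) (hd : fwd X t = t) :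
    Tendsto (retract X t₀) (𝓝[Set.Ici t₀] t) (𝓝[ray X t₀] t) := by
  refine tendsto_nhdsWithin_iff.2 ⟨?_, eventually_nhdsWithin_of_forall fun s hs => h.retract_mem hs⟩
  rw [tendsto_order]
  constructor
  · intro a ha
    rcases ht.2.eq_or_lt with he | hlt
    · filter_upwards [self_mem_nhdsWithin] with s hs
      exact ha.trans_le (he ▸ (h.retract_mem hs).2)
    · obtain ⟨b, hb, hab, hbt⟩ := exists_mem_Ioo_of_bwd_eq (h.bwd_eq_of_fwd_eq ht hd)
        (max_lt ha hlt) h.mem hlt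
      filter_upwards [mem_nhdsWithin_of_mem_nhds (lt_mem_nhds hbt)] with s hs
      exact (le_max_left _ _).trans_lt (hab.trans_le
        (le_retract ⟨hb, (le_max_right _ _).trans hab.le⟩ hs.le))
  · intro b hb
    filter_upwards [self_mem_nhdsWithin, mem_nhdsWithin_of_mem_nhds (gt_mem_nhds hb)] with s h1 h2
    exact (retract_le h.mem h1).trans_lt h2

/-! ### Delta integrals along the retraction -/

section Integral

variable {E : Type*} [NormedAddCommGroup E]

theorem aestronglyMeasurable_of_continuousOn {f : ℝ → E} (hf : ContinuousOn f (ray X t₀)) :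
    AEStronglyMeasurable f (deltaMeasure X t₀) := by
  have hm := (isClosed_ray h.isClosed t₀).measurableSet
  have hr : (deltaMeasure X t₀).restrict (ray X t₀) = deltaMeasure X t₀ := by
    rw [Measure.restrict_eq_self_of_ae_mem]
    exact deltaMeasure_compl h.isClosed h.mem
  rw [← hr]
  exact hf.aestronglyMeasurable hm

theorem aestronglyMeasurable_comp_retract {f : ℝ → E} (hf : ContinuousOn f (ray X t₀)) :
    AEStronglyMeasurable (fun s => f (retract X t₀ s)) (volume.restrict (Set.Ici t₀)) :=
  (h.aestronglyMeasurable_of_continuousOn hf).comp_aemeasurable (aemeasurable_retract h.mem)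

theorem exists_bound {f : ℝ → E} (hf : ContinuousOn f (ray X t₀)) (b : ℝ) :
    ∃ C, ∀ s ∈ Set.Icc t₀ b, ‖f (retract X t₀ s)‖ ≤ C := by
  have hc : IsCompact (ray X t₀ ∩ Set.Icc t₀ b) :=
    isCompact_Icc.inter_left (isClosed_ray h.isClosed t₀)
  obtain ⟨C, hC⟩ := hc.exists_bound_of_continuousOn (hf.mono Set.inter_subset_left)
  refine ⟨C, fun s hs => hC _ ⟨h.retract_mem hs.1, (h.retract_mem hs.1).2, ?_⟩⟩
  exact (retract_le h.mem hs.1).trans hs.2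

theorem intervalIntegrable {f : ℝ → E} (hf : ContinuousOn f (ray X t₀)) {a b : ℝ}
    (ha : t₀ ≤ a) (hb : t₀ ≤ b) :
    IntervalIntegrable (fun s => f (retract X t₀ s)) volume a b := by
  rw [intervalIntegrable_iff]
  obtain ⟨C, hC⟩ := h.exists_bound hf (max a b)
  have hsub : Set.uIoc a b ⊆ Set.Icc t₀ (max a b) := fun s hs =>
    ⟨(le_min ha hb).trans hs.1.le, hs.2⟩
  refine Integrable.mono' (g := fun _ => C) (integrableOn_const (by simp)) ?_ ?_
  · exact (h.aestronglyMeasurable_comp_retract hf).mono_set fun s hs => (hsub hs).1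
  · exact (ae_restrict_iff' measurableSet_uIoc).2 (ae_of_all _ fun s hs => hC s (hsub hs))

variable [NormedSpace ℝ E]

theorem hasDeltaDeriv_iff_of_lt {f : ℝ → E} {d : E} {t : ℝ} (ht : t ∈ ray X t₀)
    (hs : t < fwd X t) :
    HasDeltaDeriv X t₀ f d t ↔ f (fwd X t) - f t = (fwd X t - t) • d := by
  have hne : fwd X t - t ≠ 0 := (sub_pos.2 hs).ne'
  rw [HasDeltaDeriv, h.nhdsWithin_ray_diff_of_lt ht hs]
  constructor
  · intro hd
    have := tendsto_nhds_unique hd (tendsto_pure_nhds _ t)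
    rw [this, smul_inv_smul₀ hne]
  · intro he
    have := tendsto_pure_nhds (fun s => (fwd X t - s)⁻¹ • (f (fwd X t) - f s)) t
    rwa [he, inv_smul_smul₀ hne] at this

variable [CompleteSpace E]

/-- The delta derivative of a delta integral with respect to its upper end. -/
theorem hasDeltaDeriv_integral {f : ℝ → E} (hf : ContinuousOn f (ray X t₀)) {t : ℝ}
    (ht : t ∈ ray X t₀) :
    HasDeltaDeriv X t₀ (fun t => ∫ s in t₀..t, f (retract X t₀ s)) (f t) t := by
  have hsub : ∀ s ∈ ray X t₀, ∀ u ∈ ray X t₀, (∫ x in t₀..u, f (retract X t₀ x)) -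
      ∫ x in t₀..s, f (retract X t₀ x) = ∫ x in s..u, f (retract X t₀ x) := fun s hs u hu =>
    intervalIntegral.integral_interval_sub_left (h.intervalIntegrable hf le_rfl hu.2)
      (h.intervalIntegrable hf le_rfl hs.2)
  rcases (h.le_fwd t).eq_or_lt with hd | hs
  · rw [HasDeltaDeriv, ← hd, Metric.tendsto_nhds]
    intro ε hε
    have h1 := ((hf t ht).tendsto.comp (h.tendsto_retract ht hd.symm))
    have h2 := (Metric.tendsto_nhds.1 h1 (ε / 2) (half_pos hε))
    rw [eventually_nhdsWithin_iff, Metric.eventually_nhds_iff] at h2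
    obtain ⟨r, hr, h2⟩ := h2
    filter_upwards [self_mem_nhdsWithin, mem_nhdsWithin_of_mem_nhds (Metric.ball_mem_nhds t hr)]
      with s h3 h4
    have hne : t - s ≠ 0 := sub_ne_zero.2 fun e => h3.2 e.symm
    rw [hsub s h3.1 t ht]
    have h5 : ‖∫ x in s..t, (f (retract X t₀ x) - f t)‖ ≤ ε / 2 * |t - s| := by
      refine intervalIntegral.norm_integral_le_of_norm_le_const fun x hx => ?_
      have h6 : t₀ ≤ x := (le_min h3.1.2 ht.2).trans hx.1.le
      have h7 : dist x t < r := by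
        rw [Metric.mem_ball, Real.dist_eq] at h4
        rw [Real.dist_eq]
        have := Set.abs_sub_right_of_mem_uIcc (Set.uIoc_subset_uIcc hx)
        rw [abs_sub_comm s t] at h4
        rw [abs_sub_comm x t]
        exact this.trans_lt h4
      have := (h2 h7 h6).le
      rwa [Function.comp, dist_eq_norm] at this
    rw [intervalIntegral.integral_sub (h.intervalIntegrable hf h3.1.2 ht.2) (by simp),
      intervalIntegral.integral_const] at h5
    rw [dist_eq_norm]
    have h8 : (t - s)⁻¹ • (∫ x in s..t, f (retract X t₀ x)) - f t =
        (t - s)⁻¹ • ((∫ x in s..t, f (retract X t₀ x)) - (t - s) • f t) := by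
      rw [smul_sub, inv_smul_smul₀ hne]
    rw [h8, norm_smul, norm_inv, Real.norm_eq_abs]
    have h9 : 0 < |t - s| := abs_pos.2 hne
    calc |t - s|⁻¹ * _ ≤ |t - s|⁻¹ * (ε / 2 * |t - s|) := by gcongr
      _ = ε / 2 := by field_simp
      _ < ε := half_lt_self hε
  · rw [h.hasDeltaDeriv_iff_of_lt ht hs, hsub t ht _ (h.fwd_mem ht)]
    rw [← intervalIntegral.integral_const]
    refine intervalIntegral.integral_congr_ae ?_
    -- On `[t, σ(t))` the retraction is constantly `t`; the right endpoint, where it jumps, is a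
    -- null set.
    filter_upwards [Measure.ae_ne volume (fwd X t)] with s h1 h2
    rw [Set.uIoc_of_le hs.le] at h2
    rw [h.retract_eq_of_mem_Ico ht ⟨h2.1.le, lt_of_le_of_ne h2.2 h1⟩]

end Integral

end IsSturmian


/-! ### Delta derivatives and the fundamental theorem of calculus -/

namespace IsSturmian

variable {X : Set ℝ} {t₀ : ℝ}

section Topological

variable {E : Type*} [TopologicalSpace E] [AddCommGroup E] [Module ℝ E]

theorem hasDeltaDeriv_unique (h : IsSturmian X t₀) [T2Space E] {f : ℝ → E} {d e : E} {t : ℝ}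
    (ht : t ∈ ray X t₀) (hd : HasDeltaDeriv X t₀ f d t) (he : HasDeltaDeriv X t₀ f e t) : d = e :=
  haveI := h.neBot_nhdsWithin_diff ht
  tendsto_nhds_unique hd he

theorem continuousWithinAt_of_hasDeltaDeriv (h : IsSturmian X t₀) [IsTopologicalAddGroup E]
    [ContinuousSMul ℝ E] {f : ℝ → E} {d : E} {t : ℝ} (ht : t ∈ ray X t₀)
    (hd : HasDeltaDeriv X t₀ f d t) : ContinuousWithinAt f (ray X t₀) t := by
  rcases (h.le_fwd t).eq_or_lt with he | hs
  · rw [HasDeltaDeriv, ← he] at hd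
    have h1 : Tendsto (fun s => t - s) (𝓝[ray X t₀ \ {t}] t) (𝓝 (t - t)) :=
      ((continuous_const.sub continuous_id).tendsto t).mono_left nhdsWithin_le_nhds
    have h2 := (tendsto_const_nhds (x := f t)).sub (h1.smul hd)
    rw [sub_self, zero_smul, sub_zero] at h2
    rw [← continuousWithinAt_sdiff_self]
    refine h2.congr' (eventually_nhdsWithin_of_forall fun s hs => ?_)
    have hne : t - s ≠ 0 := sub_ne_zero.2 fun e => hs.2 e.symm
    simp only [smul_inv_smul₀ hne, sub_sub_cancel]
  · rw [ContinuousWithinAt, h.nhdsWithin_ray_of_lt ht hs]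
    exact tendsto_pure_nhds f t

theorem apply_fwd_of_hasDeltaDeriv (h : IsSturmian X t₀) [T2Space E] {f : ℝ → E} {d : E} {t : ℝ}
    (ht : t ∈ ray X t₀) (hd : HasDeltaDeriv X t₀ f d t) :
    f (fwd X t) = f t + (fwd X t - t) • d := by
  rcases (h.le_fwd t).eq_or_lt with he | hs
  · simp [← he]
  · have hne : fwd X t - t ≠ 0 := (sub_pos.2 hs).ne'
    rw [HasDeltaDeriv, h.nhdsWithin_ray_diff_of_lt ht hs] at hd
    have := tendsto_nhds_unique hd (tendsto_pure_nhds _ t)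
    rw [this, smul_inv_smul₀ hne, add_sub_cancel]

end Topological

theorem hasDeltaDeriv_congr (h : IsSturmian X t₀) {E : Type*} [TopologicalSpace E]
    [AddCommGroup E] [Module ℝ E] {f g : ℝ → E} {d : E} {t : ℝ} (hfg : Set.EqOn f g (ray X t₀))
    (ht : t ∈ ray X t₀) (hd : HasDeltaDeriv X t₀ f d t) : HasDeltaDeriv X t₀ g d t := by
  refine hd.congr' (eventually_nhdsWithin_of_forall fun s hs => ?_)
  simp only [hfg hs.1, hfg (h.fwd_mem ht)]

section Normed

variable {E : Type*} [NormedAddCommGroup E] [NormedSpace ℝ E] (h : IsSturmian X t₀)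
include h

/-- A function with vanishing delta derivative is constant. -/
theorem eq_of_hasDeltaDeriv_zero {f : ℝ → E}
    (hf : ∀ t ∈ ray X t₀, HasDeltaDeriv X t₀ f 0 t) {t : ℝ} (ht : t ∈ ray X t₀) :
    f t = f t₀ := by
  -- The plan is to show that `f ∘ retract` is continuous on a real half-line with right derivative
  -- zero. This identity removes the jumps it could have at scattered points.
  have hfwd : ∀ u ∈ ray X t₀, f (fwd X u) = f u := fun u hu => by
    simpa using h.apply_fwd_of_hasDeltaDeriv hu (hf u hu)
  have hdense : ∀ s, t₀ ≤ s → fwd X (retract X t₀ s) = retract X t₀ s → retract X t₀ s = s := by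
    intro s hs hd
    refine (retract_le h.mem hs).eq_of_not_lt fun hlt => ?_
    obtain ⟨b, hb, h1, h2⟩ := h.exists_mem_lt_of_fwd_eq hd hlt
    exact absurd (le_retract ⟨hb, (h.retract_mem hs).2.trans h1.le⟩ h2.le) (not_le.2 h1)
  have hlt : ∀ s, t₀ ≤ s → retract X t₀ s < fwd X (retract X t₀ s) →
      s < fwd X (retract X t₀ s) := by
    intro s hs h1
    by_contra! h2
    exact absurd (le_retract (h.fwd_mem (h.retract_mem hs)) h2) (not_le.2 h1)
  have hcont : ContinuousOn (fun s => f (retract X t₀ s)) (Set.Ici t₀) := by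
    intro s hs
    have hu := h.retract_mem hs
    have hus := retract_le h.mem hs
    rcases (h.le_fwd (retract X t₀ s)).eq_or_lt with he | hs'
    · have hs2 := hdense s hs he.symm
      rw [hs2] at hu he
      have h1 := (h.continuousWithinAt_of_hasDeltaDeriv hu (hf s hu)).tendsto.comp
        (h.tendsto_retract hu he.symm)
      rw [ContinuousWithinAt, hs2]
      exact h1
    · have hbu := h.bwd_lt hu hs'
      have hss := hlt s hs hs'
      refine (tendsto_const_nhds (x := f (retract X t₀ s))).congr' ?_
      filter_upwards [self_mem_nhdsWithin, mem_nhdsWithin_of_mem_nhds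
        (Ioo_mem_nhds (hbu.trans_le hus) hss)] with x h1 h2
      rcases le_or_gt (retract X t₀ s) x with h3 | h3
      · rw [h.retract_eq_of_mem_Ico hu ⟨h3, h2.2⟩]
      -- Just left of an isolated point the retraction drops to the predecessor, where `f` has the
      -- same value by `hfwd`.
      · have h4 : t₀ < retract X t₀ s := lt_of_le_of_lt h1 h3
        have h5 := h.sturmian _ hu
        have h6 : bwd X (retract X t₀ s) ∈ ray X t₀ := by
          refine ⟨?_, le_bwd h.mem h4⟩
          rw [bwd, if_pos ⟨t₀, h.mem, h4⟩]
          have hm := csSup_mem_closure (s := {x | x ∈ X ∧ x < retract X t₀ s}) ⟨t₀, h.mem, h4⟩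
            ⟨_, fun _ h => h.2.le⟩
          exact h.isClosed.closure_subset_iff.2 (fun _ h => h.1) hm
        rw [h.retract_eq_of_mem_Ico h6 ⟨h2.1.le, by rwa [h5.1]⟩, ← hfwd _ h6, h5.1]
  have hder : ∀ s ∈ Set.Ico t₀ t,
      HasDerivWithinAt (fun s => f (retract X t₀ s)) 0 (Set.Ici s) s := by
    intro s hs
    have hu := h.retract_mem hs.1
    rcases (h.le_fwd (retract X t₀ s)).eq_or_lt with he | hs'
    · have hs2 := hdense s hs.1 he.symm
      rw [hs2] at hu he
      have hd := hf s hu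
      rw [HasDeltaDeriv, ← he, Metric.tendsto_nhds] at hd
      rw [hasDerivWithinAt_iff_isLittleO, Asymptotics.isLittleO_iff]
      intro ε hε
      have h1 := (h.tendsto_retract hu he.symm).mono_left
        (nhdsWithin_mono s (Set.Ici_subset_Ici.2 hs.1))
      have h2 := eventually_nhdsWithin_iff.1 (hd ε hε)
      filter_upwards [self_mem_nhdsWithin, h1.eventually self_mem_nhdsWithin,
        (h1.mono_right nhdsWithin_le_nhds).eventually h2] with x hx h3 h4
      simp only [smul_zero, sub_zero, hs2]
      by_cases h5 : retract X t₀ x = s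
      · rw [h5, sub_self, norm_zero]
        positivity
      · have h6 := h4 ⟨h3, h5⟩
        have h7 : s ≤ retract X t₀ x := le_retract hu hx
        have h8 : retract X t₀ x ≤ x := retract_le h.mem (hs.1.trans hx)
        have h9 : 0 < retract X t₀ x - s := sub_pos.2 (lt_of_le_of_ne h7 (Ne.symm h5))
        rw [dist_zero_right, norm_smul, norm_inv, norm_sub_rev (f s), norm_sub_rev s,
          Real.norm_of_nonneg h9.le, inv_mul_lt_iff₀ h9] at h6
        rw [Real.norm_of_nonneg (sub_nonneg.2 hx)]
        -- The estimate along the scale transfers to real `x` because the retraction never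
        -- overshoots.
        calc _ ≤ (retract X t₀ x - s) * ε := h6.le
          _ ≤ ε * (x - s) := by rw [mul_comm]; gcongr
    · refine (hasDerivWithinAt_const s (Set.Ici s) (f (retract X t₀ s))).congr_of_eventuallyEq
        ?_ rfl
      filter_upwards [self_mem_nhdsWithin, mem_nhdsWithin_of_mem_nhds
        (gt_mem_nhds (hlt s hs.1 hs'))] with x h1 h2
      rw [h.retract_eq_of_mem_Ico hu ⟨(retract_le h.mem hs.1).trans h1, h2⟩]
  have := constant_of_has_deriv_right_zero (hcont.mono Set.Icc_subset_Ici_self) hder t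
    ⟨ht.2, le_rfl⟩
  simpa only [retract_of_mem ht, retract_of_mem h.start_mem] using this

variable [CompleteSpace E]

/-- The fundamental theorem of calculus for delta integrals. -/
theorem integral_eq_sub {F f : ℝ → E} (hf : ContinuousOn f (ray X t₀))
    (hF : ∀ t ∈ ray X t₀, HasDeltaDeriv X t₀ F (f t) t) {a b : ℝ} (ha : a ∈ ray X t₀)
    (hb : b ∈ ray X t₀) : ∫ s in a..b, f (retract X t₀ s) = F b - F a := by
  have key : ∀ t ∈ ray X t₀, F t - ∫ s in t₀..t, f (retract X t₀ s) = F t₀ := by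
    intro t ht
    have := h.eq_of_hasDeltaDeriv_zero
      (f := fun t => F t - ∫ s in t₀..t, f (retract X t₀ s)) (fun t ht => ?_) ht
    · simpa using this
    · have h1 := (hF t ht).sub (h.hasDeltaDeriv_integral hf ht)
      rw [sub_self] at h1
      refine h1.congr fun s => ?_
      rw [← smul_sub]
      exact congrArg _ (sub_sub_sub_comm _ _ _ _)
  rw [← intervalIntegral.integral_interval_sub_left (h.intervalIntegrable hf le_rfl hb.2)
    (h.intervalIntegrable hf le_rfl ha.2)]
  have h1 := key a ha
  rw [← key b hb] at h1
  rw [sub_eq_sub_iff_sub_eq_sub] at h1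
  rw [← neg_sub (F a), h1]
  abel

end Normed

end IsSturmian


/-! ### Linear delta differential equations -/

namespace IsSturmian

variable {X : Set ℝ} {t₀ : ℝ} (h : IsSturmian X t₀) {E : Type*} [NormedAddCommGroup E]
  [NormedSpace ℝ E]

/-- The Picard iterates for `u^Δ = K u`, `u(t₀) = u₀`. -/
noncomputable def picard (X : Set ℝ) (t₀ : ℝ) (K : ℝ → E →L[ℝ] E) (u₀ : E) : ℕ → ℝ → E
  | 0 => fun _ => u₀
  | k + 1 => fun s => ∫ x in t₀..s, K (retract X t₀ x) (picard X t₀ K u₀ k (retract X t₀ x))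

variable {K : ℝ → E →L[ℝ] E} {u₀ : E}

-- The weight `exp (2L(s - t₀))` makes each integration against `‖K‖ ≤ L` gain a factor `1/2`. Since
-- the weight is increasing, replacing `x` by `retract x ≤ x` costs nothing, so scattered points
-- need no separate treatment.
include h in
theorem norm_picard_le {T L : ℝ} (hL : 0 < L)
    (hKL : ∀ s ∈ Set.Icc t₀ T, ‖K (retract X t₀ s)‖ ≤ L) (k : ℕ) :
    ∀ s ∈ Set.Icc t₀ T,
      ‖picard X t₀ K u₀ k s‖ ≤ ‖u₀‖ * (1 / 2) ^ k * Real.exp (2 * L * (s - t₀)) := by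
  induction k with
  | zero =>
    intro s hs
    have : 1 ≤ Real.exp (2 * L * (s - t₀)) :=
      Real.one_le_exp (mul_nonneg (by positivity) (sub_nonneg.2 hs.1))
    simpa [picard] using le_mul_of_one_le_right (norm_nonneg u₀) this
  | succ k ih =>
    intro s hs
    set c := ‖u₀‖ * (1 / 2) ^ k with hc
    have hc0 : 0 ≤ c := by positivity
    have hint : IntervalIntegrable (fun x => L * (c * Real.exp (2 * L * (x - t₀)))) volume t₀ s :=
      Continuous.intervalIntegrable (by fun_prop) _ _
    have hder : ∀ x ∈ Set.uIcc t₀ s, HasDerivAt (fun x => c / 2 * Real.exp (2 * L * (x - t₀)))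
        (L * (c * Real.exp (2 * L * (x - t₀)))) x := by
      intro x _
      refine ((((hasDerivAt_id x).sub_const t₀).const_mul (2 * L)).exp.const_mul
        (c / 2)).congr_deriv ?_
      simp only [id]
      ring
    have h1 : ‖picard X t₀ K u₀ (k + 1) s‖ ≤
        ∫ x in t₀..s, L * (c * Real.exp (2 * L * (x - t₀))) := by
      refine intervalIntegral.norm_integral_le_of_norm_le hs.1 (ae_of_all _ fun x hx => ?_) hint
      have hxs : x ∈ Set.Icc t₀ T := ⟨hx.1.le, hx.2.trans hs.2⟩
      have hrx := retract_le h.mem hxs.1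
      refine (ContinuousLinearMap.le_opNorm _ _).trans ?_
      refine mul_le_mul (hKL x hxs) ((ih _ ⟨(h.retract_mem hxs.1).2, hrx.trans hxs.2⟩).trans ?_)
        (norm_nonneg _) hL.le
      gcongr
    rw [intervalIntegral.integral_eq_sub_of_hasDerivAt hder hint] at h1
    refine h1.trans ?_
    rw [sub_self, mul_zero, Real.exp_zero, pow_succ, ← mul_assoc, ← hc]
    linarith

variable [CompleteSpace E]

include h in
theorem continuousOn_picard (hK : ContinuousOn K (ray X t₀)) (k : ℕ) :
    ContinuousOn (picard X t₀ K u₀ k) (ray X t₀) := by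
  induction k with
  | zero => exact continuousOn_const
  | succ k ih =>
    intro t ht
    exact h.continuousWithinAt_of_hasDeltaDeriv ht (h.hasDeltaDeriv_integral (hK.clm_apply ih) ht)

include h in
/-- Linear delta differential equations with continuous coefficients are solvable. -/
theorem exists_solution (hK : ContinuousOn K (ray X t₀)) (u₀ : E) :
    ∃ u : ℝ → E, u t₀ = u₀ ∧ ∀ t ∈ ray X t₀, HasDeltaDeriv X t₀ u (K t (u t)) t := by
  -- The iterates are the individual terms of the Neumann series, so the solution is their sum.
  set u : ℝ → E := fun s => ∑' k, picard X t₀ K u₀ k s with hu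
  have hbound : ∀ T, ∃ C, ∀ k, ∀ s ∈ Set.Icc t₀ T, ‖picard X t₀ K u₀ k s‖ ≤ C * (1 / 2) ^ k := by
    intro T
    obtain ⟨C, hC⟩ := h.exists_bound hK T
    refine ⟨‖u₀‖ * Real.exp (2 * (max C 1) * (T - t₀)), fun k s hs => ?_⟩
    refine (h.norm_picard_le (lt_max_of_lt_right one_pos)
      (fun s hs => (hC s hs).trans (le_max_left C 1)) k s hs).trans ?_
    rw [mul_right_comm]
    have := hs.2
    gcongr
  have hgeom : ∀ C : ℝ, Summable fun k : ℕ => C * (1 / 2 : ℝ) ^ k := fun C =>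
    summable_geometric_two.mul_left C
  have hsum : ∀ s, t₀ ≤ s → HasSum (fun k => picard X t₀ K u₀ k s) (u s) := by
    intro s hs
    obtain ⟨C, hC⟩ := hbound s
    exact (Summable.of_norm_bounded (hgeom C) fun k => hC k s ⟨hs, le_rfl⟩).hasSum
  have hcont : ContinuousOn u (ray X t₀) := by
    intro t ht
    obtain ⟨C, hC⟩ := hbound (t + 1)
    have h1 : ContinuousOn u (ray X t₀ ∩ Set.Iio (t + 1)) :=
      continuousOn_tsum (fun k => (h.continuousOn_picard hK k).mono Set.inter_subset_left)
        (hgeom C) fun k s hs => hC k s ⟨hs.1.2, hs.2.le⟩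
    exact (h1 t ⟨ht, lt_add_one t⟩).mono_of_mem_nhdsWithin
      (inter_mem_nhdsWithin _ (Iio_mem_nhds (lt_add_one t)))
  have hKu := hK.clm_apply hcont
  have hint : ∀ t, t₀ ≤ t →
      u t = u₀ + ∫ x in t₀..t, K (retract X t₀ x) (u (retract X t₀ x)) := by
    intro t ht
    obtain ⟨C, hC⟩ := hbound t
    obtain ⟨L, hL⟩ := h.exists_bound hK t
    have h1 : HasSum (fun k => picard X t₀ K u₀ (k + 1) t)
        (∫ x in t₀..t, K (retract X t₀ x) (u (retract X t₀ x))) := by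
      refine intervalIntegral.hasSum_integral_of_dominated_convergence
        (fun k _ => L * (C * (1 / 2) ^ k)) (fun k => ?_) (fun k => ae_of_all _ fun x hx => ?_)
        (ae_of_all _ fun x _ => (hgeom C).mul_left L) (by simp) (ae_of_all _ fun x hx => ?_)
      · refine (h.aestronglyMeasurable_comp_retract
          (hK.clm_apply (h.continuousOn_picard hK k))).mono_set fun s hs => ?_
        rw [Set.uIoc_of_le ht] at hs
        exact hs.1.le
      · rw [Set.uIoc_of_le ht] at hx
        have h2 := h.retract_mem hx.1.le
        exact ((K _).le_opNorm _).trans (mul_le_mul (hL x ⟨hx.1.le, hx.2⟩)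
          (hC k _ ⟨h2.2, (retract_le h.mem hx.1.le).trans hx.2⟩) (norm_nonneg _)
          ((norm_nonneg _).trans (hL x ⟨hx.1.le, hx.2⟩)))
      · rw [Set.uIoc_of_le ht] at hx
        exact (K _).hasSum (hsum _ (h.retract_mem hx.1.le).2)
    have h2 := (hasSum_nat_add_iff' 1).2 (hsum t ht)
    rw [Finset.sum_range_one] at h2
    rw [← h2.unique h1]
    simp [picard]
  refine ⟨u, by simpa using hint t₀ le_rfl, fun t ht => ?_⟩
  refine h.hasDeltaDeriv_congr (fun s hs => (hint s hs.2).symm) ht ?_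
  refine (h.hasDeltaDeriv_integral hKu ht).congr fun s => ?_
  rw [add_sub_add_left_eq_sub]

end IsSturmian


/-! ### Block matrices -/

theorem J_mul_J (n : ℕ) : J n * J n = -1 := by
  rw [J, Matrix.fromBlocks_multiply, ← Matrix.fromBlocks_one, Matrix.fromBlocks_neg]
  simp

theorem conjTranspose_J (n : ℕ) : (J n)ᴴ = -J n := by
  rw [J, Matrix.fromBlocks_conjTranspose, Matrix.fromBlocks_neg]
  simp

theorem J_mul_rot_mul_J {n : ℕ} (V : Matrix (Fin n) (Fin n) ℂ) : J n * rot V * J n = (rot V)ᴴ := by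
  rw [J, rot, Matrix.fromBlocks_multiply, Matrix.fromBlocks_multiply,
    Matrix.fromBlocks_conjTranspose]
  simp

theorem rot_mul_J {n : ℕ} (V : Matrix (Fin n) (Fin n) ℂ) :
    rot V * J n = Matrix.fromBlocks 0 (-V) (-Vᴴ) 0 := by
  rw [J, rot, Matrix.fromBlocks_multiply]
  simp

theorem isHermitian_rot_mul_J {n : ℕ} (V : Matrix (Fin n) (Fin n) ℂ) :
    (rot V * J n).IsHermitian := by
  rw [rot_mul_J, Matrix.IsHermitian, Matrix.fromBlocks_conjTranspose]
  simp

theorem conjTranspose_fromRows_mul_mul {n : ℕ} {m k : Type*} (P Q : Matrix (Fin n) (Fin n) ℂ)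
    (a b : Matrix (Fin n) k ℂ) (c d : Matrix (Fin n) m ℂ) :
    (Matrix.fromRows a b)ᴴ * Matrix.fromBlocks 0 P Q 0 * Matrix.fromRows c d =
      aᴴ * (P * d) + bᴴ * (Q * c) := by
  rw [Matrix.mul_assoc, Matrix.fromBlocks_mul_fromRows,
    Matrix.conjTranspose_fromRows_eq_fromCols_conjTranspose, Matrix.fromCols_mul_fromRows]
  simp

theorem fromRows_add_smul {m n p : Type*} (μ : ℝ) (a e : Matrix m p ℂ) (b f : Matrix n p ℂ) :
    Matrix.fromRows a b + μ • Matrix.fromRows e f = Matrix.fromRows (a + μ • e) (b + μ • f) := by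
  ext i j
  cases i <;> rfl

theorem continuous_fromBlocks {m n p q : Type*} : Continuous
    fun M : Matrix m p ℂ × Matrix m q ℂ × Matrix n p ℂ × Matrix n q ℂ =>
      Matrix.fromBlocks M.1 M.2.1 M.2.2.1 M.2.2.2 := by
  apply Continuous.matrix_fromBlocks <;> fun_prop

theorem continuous_fromRows {m n p : Type*} : Continuous
    fun M : Matrix m p ℂ × Matrix n p ℂ => Matrix.fromRows M.1 M.2 := by
  refine continuous_matrix fun i j => ?_
  cases i with
  | inl i => exact continuous_fst.matrix_elem i j
  | inr i => exact continuous_snd.matrix_elem i j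

theorem continuous_toRows₁ {m n p : Type*} :
    Continuous fun M : Matrix (m ⊕ n) p ℂ => M.toRows₁ :=
  continuous_matrix fun i j => continuous_id.matrix_elem (Sum.inl i) j

theorem continuous_toRows₂ {m n p : Type*} :
    Continuous fun M : Matrix (m ⊕ n) p ℂ => M.toRows₂ :=
  continuous_matrix fun i j => continuous_id.matrix_elem (Sum.inr i) j

theorem continuous_toBlocks₁₁ {m n p q : Type*} :
    Continuous fun M : Matrix (m ⊕ n) (p ⊕ q) ℂ => M.toBlocks₁₁ :=
  continuous_matrix fun i j => continuous_id.matrix_elem (Sum.inl i) (Sum.inl j)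

theorem continuous_toBlocks₁₂ {m n p q : Type*} :
    Continuous fun M : Matrix (m ⊕ n) (p ⊕ q) ℂ => M.toBlocks₁₂ :=
  continuous_matrix fun i j => continuous_id.matrix_elem (Sum.inl i) (Sum.inr j)

namespace HamiltonianSystem

variable {n : ℕ} (S : HamiltonianSystem n)

theorem isSturmian : IsSturmian S.X S.t₀ := ⟨S.isClosed, S.unbounded, S.t₀_mem, S.sturmian⟩

theorem continuousOn_A : ContinuousOn S.A S.T := by
  have h₁ := S.isSturmian.continuousOn_of_rdContinuous S.rd_A₁
  have h₂ := S.isSturmian.continuousOn_of_rdContinuous S.rd_A₂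
  exact continuous_fromBlocks.comp_continuousOn
    (h₁.prodMk (continuousOn_const.prodMk (continuousOn_const.prodMk h₂)))

theorem continuousOn_B : ContinuousOn S.B S.T := by
  have h₁ := S.isSturmian.continuousOn_of_rdContinuous S.rd_B₁
  have h₂ := S.isSturmian.continuousOn_of_rdContinuous S.rd_B₂
  have h₃ := S.isSturmian.continuousOn_of_rdContinuous S.rd_B₃
  have h₄ := S.isSturmian.continuousOn_of_rdContinuous S.rd_B₄
  exact continuous_fromBlocks.comp_continuousOn (h₁.prodMk (h₂.prodMk (h₃.prodMk h₄)))

/-! ### Solvability -/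

section Existence

attribute [local instance] Matrix.linftyOpNormedRing Matrix.linftyOpNormedAlgebra

-- The system involves `y` while the derivative is that of `u = ŷ`. The second row of `y` is that of
-- `u` advanced by one jump, so the system yields `(1 + μ C₁₂) y₂ = u₂ - μ C₁₁ u₁`. Inverting gives
-- `y = P u` with the block triangular `P` on the left, which makes the equation explicit.
omit S in
theorem fromRows_add_smul_eq (C : Mat2 n) (μ : ℝ) {r : Matrix (Fin n) (Fin n) ℂ}
    (hr : (1 + μ • C.toBlocks₁₂) * r = 1) (u : Mat2 n) :
    Matrix.fromBlocks 1 0 (-(r * (μ • C.toBlocks₁₁))) r * u = Matrix.fromRows u.toRows₁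
      (u + μ • -(J n *
        (C * (Matrix.fromBlocks 1 0 (-(r * (μ • C.toBlocks₁₁))) r * u)))).toRows₂ := by
  obtain ⟨a, b, rfl⟩ : ∃ a b, u = Matrix.fromRows a b := ⟨_, _, (Matrix.fromRows_toRows _).symm⟩
  have hb : b - μ • (C.toBlocks₁₁ * a) =
      (1 + μ • C.toBlocks₁₂) * (r * (b - μ • (C.toBlocks₁₁ * a))) := by
    rw [← Matrix.mul_assoc, hr, Matrix.one_mul]
  conv_rhs => rw [← Matrix.fromBlocks_toBlocks C]
  simp only [J, Matrix.fromBlocks_mul_fromRows]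
  ext i j
  cases i with
  | inl i => simp
  | inr i =>
    have h1 := congrFun (congrFun hb i) j
    simp [Matrix.toRows₂, Matrix.add_mul, Matrix.mul_add, Matrix.mul_sub, Matrix.mul_assoc] at h1 ⊢
    linear_combination -h1

theorem exists_isSolution {C : ℝ → Mat2 n} (hC : ContinuousOn C S.T)
    (hreg : ∀ t ∈ S.T, IsUnit (1 + (fwd S.X t - t) • (C t).toBlocks₁₂)) :
    ∃ Y : ℝ → Mat2 n, S.IsSolution C Y ∧ S.hat Y S.t₀ = J n := by
  have h := S.isSturmian
  set R : ℝ → Matrix (Fin n) (Fin n) ℂ :=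
    fun t => Ring.inverse (1 + (fwd S.X t - t) • (C t).toBlocks₁₂) with hR
  set P : ℝ → Mat2 n := fun t =>
    Matrix.fromBlocks 1 0 (-(R t * ((fwd S.X t - t) • (C t).toBlocks₁₁))) (R t) with hP
  have hμ : ContinuousOn (fun t => fwd S.X t - t) S.T := h.continuousOn_fwd.sub continuousOn_id
  have hRc : ContinuousOn R S.T := by
    intro t ht
    obtain ⟨r, hr⟩ := hreg t ht
    have h1 : ContinuousWithinAt (fun t => 1 + (fwd S.X t - t) • (C t).toBlocks₁₂) S.T t :=
      (continuousOn_const.add (hμ.smul (continuous_toBlocks₁₂.comp_continuousOn hC))) t ht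
    refine ContinuousAt.comp_continuousWithinAt (g := Ring.inverse) ?_ h1
    rw [← hr]
    exact NormedRing.inverse_continuousAt r
  have hPc : ContinuousOn P S.T := by
    refine continuous_fromBlocks.comp_continuousOn
      (continuousOn_const.prodMk (continuousOn_const.prodMk (ContinuousOn.prodMk ?_ hRc)))
    exact (hRc.mul (hμ.smul (continuous_toBlocks₁₁.comp_continuousOn hC))).neg
  have hK : ContinuousOn
      (fun t => ContinuousLinearMap.mul ℝ (Mat2 n) (-(J n * (C t * P t)))) S.T :=
    (ContinuousLinearMap.mul ℝ (Mat2 n)).continuous.comp_continuousOn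
      (continuousOn_const.mul (hC.mul hPc)).neg
  obtain ⟨u, hu₀, hu⟩ := h.exists_solution hK (J n)
  -- The solution is `u` with its second row advanced by `σ`; since `σ ∘ ρ` is the identity, the
  -- partial shift returns `u`, at `t₀` too.
  have hhat : Set.EqOn u (S.hat fun s => Matrix.fromRows (u s).toRows₁ (u (fwd S.X s)).toRows₂)
      S.T := by
    intro t ht
    simp only [hat, Matrix.toRows₁_fromRows, Matrix.toRows₂_fromRows, (S.sturmian t ht).1,
      Matrix.fromRows_toRows]
  refine ⟨_, fun t ht => ⟨_, h.hasDeltaDeriv_congr hhat ht (hu t ht), ?_⟩,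
    (hhat h.start_mem).symm.trans hu₀⟩
  rw [ContinuousLinearMap.mul_apply', h.apply_fwd_of_hasDeltaDeriv ht (hu t ht),
    ContinuousLinearMap.mul_apply', neg_mul, mul_neg, mul_assoc, ← mul_assoc (J n), J_mul_J,
    neg_one_mul, neg_neg, mul_assoc]
  congr 1
  exact fromRows_add_smul_eq _ _ (Ring.mul_inverse_cancel _ (hreg t ht)) _

end Existence

theorem fundamental_spec {C : ℝ → Mat2 n} (hC : ContinuousOn C S.T)
    (hreg : ∀ t ∈ S.T, IsUnit (1 + (fwd S.X t - t) • (C t).toBlocks₁₂)) :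
    S.IsSolution C (S.fundamental C) ∧ S.hat (S.fundamental C) S.t₀ = J n :=
  Classical.epsilon_spec (p := fun Y => S.IsSolution C Y ∧ S.hat Y S.t₀ = J n)
    (S.exists_isSolution hC hreg)

theorem continuousOn_coeff (z : ℂ) : ContinuousOn (fun t => z • S.A t + S.B t) S.T :=
  (S.continuousOn_A.const_smul z).add S.continuousOn_B

theorem continuousOn_adjoint_coeff (z : ℂ) :
    ContinuousOn (fun t => conj z • S.A t + (S.B t)ᴴ) S.T :=
  (S.continuousOn_A.const_smul (conj z)).add
    (Continuous.matrix_conjTranspose continuous_id |>.comp_continuousOn S.continuousOn_B)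

theorem isSolution_Y (z : ℂ) :
    S.IsSolution (fun t => z • S.A t + S.B t) (S.Y z) ∧ S.hat (S.Y z) S.t₀ = J n := by
  refine S.fundamental_spec (S.continuousOn_coeff z) fun t ht => ?_
  have := S.regressive₂ t ht
  simpa [A, B, Matrix.fromBlocks_smul, Matrix.fromBlocks_add] using this

/-- The upper right block of the adjoint coefficients is `B₃*`, so solvability rests on the
invertibility of `1 + μ B₃` where the original system needs that of `1 + μ B₂`. -/
theorem isSolution_Z (z : ℂ) :
    S.IsSolution (fun t => conj z • S.A t + (S.B t)ᴴ) (S.Z z) ∧ S.hat (S.Z z) S.t₀ = J n := by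
  refine S.fundamental_spec (S.continuousOn_adjoint_coeff z) fun t ht => ?_
  have := (S.regressive₃ t ht).star
  simpa [A, B, Matrix.fromBlocks_smul, Matrix.fromBlocks_add, Matrix.fromBlocks_conjTranspose,
    Matrix.star_eq_conjTranspose, Matrix.conjTranspose_smul] using this

/-! ### Calculus for solutions -/

section Solutions

variable {S} {m k : Type*} {C E : ℝ → Mat2 n} {y : ℝ → Matrix (Fin n ⊕ Fin n) m ℂ}
  {z : ℝ → Matrix (Fin n ⊕ Fin n) k ℂ}

theorem fromRows_hat {t : ℝ} (ht : t ∈ S.T) (y : ℝ → Matrix (Fin n ⊕ Fin n) m ℂ) :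
    y t = Matrix.fromRows (S.hat y t).toRows₁ (S.hat y (fwd S.X t)).toRows₂ := by
  simp [hat, (S.sturmian t ht).2, Matrix.fromRows_toRows]

theorem hat_mul_const {l : Type*} [Fintype m] (y : ℝ → Matrix (Fin n ⊕ Fin n) m ℂ)
    (N : Matrix m l ℂ) (t : ℝ) : S.hat (fun s => y s * N) t = S.hat y t * N := by
  rw [hat, hat, Matrix.fromRows_mul]
  congr 1

theorem IsSolution.mul_const {l : Type*} [Fintype m] (hy : S.IsSolution C y) (N : Matrix m l ℂ) :
    S.IsSolution C fun s => y s * N := by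
  intro t ht
  obtain ⟨d, hd, he⟩ := hy t ht
  refine ⟨d * N, ?_, by rw [← Matrix.mul_assoc, he, Matrix.mul_assoc]⟩
  have h1 : Continuous fun M : Matrix (Fin n ⊕ Fin n) m ℂ => M * N :=
    continuous_id.matrix_mul continuous_const
  refine ((h1.tendsto d).comp hd).congr fun s => ?_
  simp only [Function.comp, hat_mul_const, Matrix.smul_mul, Matrix.sub_mul]

theorem IsSolution.continuousOn_hat (hy : S.IsSolution C y) : ContinuousOn (S.hat y) S.T := by
  intro t ht
  obtain ⟨d, hd, -⟩ := hy t ht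
  exact S.isSturmian.continuousWithinAt_of_hasDeltaDeriv ht hd

theorem IsSolution.continuousOn (hy : S.IsSolution C y) : ContinuousOn y S.T := by
  have h1 := hy.continuousOn_hat
  have h2 : ContinuousOn (fun t => S.hat y (fwd S.X t)) S.T := S.isSturmian.continuousOn_comp_fwd h1
  refine (continuous_fromRows.comp_continuousOn ((continuous_toRows₁.comp_continuousOn h1).prodMk
    (continuous_toRows₂.comp_continuousOn h2))).congr fun t ht => fromRows_hat ht y

/-- The product rule for `ẑ* H ŷ`, with `H` block off-diagonal. -/
theorem hasDeltaDeriv_conjTranspose_mul_mul (P Q : Matrix (Fin n) (Fin n) ℂ) {t : ℝ}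
    (ht : t ∈ S.T) {dy : Matrix (Fin n ⊕ Fin n) m ℂ} {dz : Matrix (Fin n ⊕ Fin n) k ℂ}
    (hy : HasDeltaDeriv S.X S.t₀ (S.hat y) dy t) (hz : HasDeltaDeriv S.X S.t₀ (S.hat z) dz t) :
    HasDeltaDeriv S.X S.t₀ (fun s => (S.hat z s)ᴴ * Matrix.fromBlocks 0 P Q 0 * S.hat y s)
      (dzᴴ * Matrix.fromBlocks 0 P Q 0 * y t + (z t)ᴴ * Matrix.fromBlocks 0 P Q 0 * dy) t := by
  have h := S.isSturmian
  set H : Mat2 n := Matrix.fromBlocks 0 P Q 0 with hH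
  have hyf := h.apply_fwd_of_hasDeltaDeriv ht hy
  have hzf := h.apply_fwd_of_hasDeltaDeriv ht hz
  -- The usual product rule has one factor at `σ(t)` and the other at `t`. Passing to the unshifted
  -- `y` and `z` changes the two terms by `∓ μ dz₂* Q dy₁`, which cancel because `H` is
  -- off-diagonal.
  have hval : dzᴴ * H * y t + (z t)ᴴ * H * dy =
      dzᴴ * H * S.hat y (fwd S.X t) + (S.hat z t)ᴴ * H * dy := by
    rw [fromRows_hat ht y, fromRows_hat ht z, hyf, hzf]
    generalize S.hat y t = u
    generalize S.hat z t = v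
    generalize fwd S.X t - t = μ
    obtain ⟨a, b, rfl⟩ : ∃ a b, u = Matrix.fromRows a b := ⟨_, _, (Matrix.fromRows_toRows _).symm⟩
    obtain ⟨c, d, rfl⟩ : ∃ a b, v = Matrix.fromRows a b := ⟨_, _, (Matrix.fromRows_toRows _).symm⟩
    obtain ⟨e, f, rfl⟩ : ∃ a b, dy = Matrix.fromRows a b := ⟨_, _, (Matrix.fromRows_toRows _).symm⟩
    obtain ⟨p, q, rfl⟩ : ∃ a b, dz = Matrix.fromRows a b := ⟨_, _, (Matrix.fromRows_toRows _).symm⟩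
    simp only [hH, fromRows_add_smul, Matrix.toRows₁_fromRows, Matrix.toRows₂_fromRows,
      conjTranspose_fromRows_mul_mul, Matrix.mul_add, Matrix.add_mul, Matrix.conjTranspose_add,
      Matrix.conjTranspose_smul, star_trivial, Matrix.smul_mul, Matrix.mul_smul]
    abel
  rw [hval]
  have hcont : Continuous fun p : Matrix (Fin n ⊕ Fin n) k ℂ × Matrix (Fin n ⊕ Fin n) m ℂ =>
      p.1ᴴ * H * p.2 :=
    (continuous_fst.matrix_conjTranspose.matrix_mul continuous_const).matrix_mul continuous_snd
  have h1 := (hcont.tendsto (dz, S.hat y (fwd S.X t))).comp (hz.prodMk_nhds tendsto_const_nhds)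
  have h2 := (hcont.tendsto (S.hat z t, dy)).comp
    (((h.continuousWithinAt_of_hasDeltaDeriv ht hz).mono Set.sdiff_subset).tendsto.prodMk_nhds hy)
  refine (h1.add h2).congr fun s => ?_
  simp only [Function.comp, Matrix.conjTranspose_smul, star_trivial, Matrix.smul_mul,
    Matrix.mul_smul, ← smul_add, Matrix.conjTranspose_sub, Matrix.sub_mul, Matrix.mul_sub]
  congr 1
  abel

theorem eq_neg_J_mul {d : Matrix (Fin n ⊕ Fin n) m ℂ} {c : Matrix (Fin n ⊕ Fin n) m ℂ}
    (h : J n * d = c) : d = -(J n * c) := by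
  rw [← h, ← Matrix.mul_assoc, J_mul_J, Matrix.neg_mul, Matrix.one_mul, neg_neg]

/-- The Lagrange identity. -/
theorem IsSolution.hasDeltaDeriv_J (hy : S.IsSolution C y) (hz : S.IsSolution E z) {t : ℝ}
    (ht : t ∈ S.T) : HasDeltaDeriv S.X S.t₀ (fun s => (S.hat z s)ᴴ * J n * S.hat y s)
      ((z t)ᴴ * (C t - (E t)ᴴ) * y t) t := by
  obtain ⟨dy, hdy, hy'⟩ := hy t ht
  obtain ⟨dz, hdz, hz'⟩ := hz t ht
  have := hasDeltaDeriv_conjTranspose_mul_mul (-1) 1 ht hdy hdz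
  rw [show Matrix.fromBlocks 0 (-1) 1 0 = J n from rfl] at this
  convert this using 1
  rw [eq_neg_J_mul hy', eq_neg_J_mul hz']
  simp only [Matrix.conjTranspose_neg, Matrix.conjTranspose_mul, conjTranspose_J, Matrix.mul_neg,
    neg_neg, Matrix.mul_sub, Matrix.sub_mul]
  rw [Matrix.mul_assoc _ (J n) (J n), J_mul_J, Matrix.mul_assoc _ (J n) (J n * _),
    ← Matrix.mul_assoc (J n) (J n), J_mul_J]
  simp only [Matrix.mul_neg, Matrix.neg_mul, Matrix.mul_one, Matrix.one_mul, Matrix.mul_assoc]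
  abel

/-- The energy identity. Inserting `d = -J C y` in the product rule, `J² = -1` handles one term and
`J V₂ₙ J = V₂ₙ*` the other, leaving twice the real part of `V₂ₙ C`. -/
theorem IsSolution.hasDeltaDeriv_rot (hy : S.IsSolution C y) (V : Matrix (Fin n) (Fin n) ℂ)
    {t : ℝ} (ht : t ∈ S.T) :
    HasDeltaDeriv S.X S.t₀ (fun s => (S.hat y s)ᴴ * (rot V * J n) * S.hat y s)
      ((y t)ᴴ * (rot V * C t + (rot V * C t)ᴴ) * y t) t := by
  obtain ⟨dy, hdy, hy'⟩ := hy t ht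
  have := hasDeltaDeriv_conjTranspose_mul_mul (-V) (-Vᴴ) ht hdy hdy
  rw [← rot_mul_J] at this
  convert this using 1
  rw [eq_neg_J_mul hy']
  have h1 : rot V * J n * (J n * (C t * y t)) = -(rot V * C t * y t) := by
    rw [Matrix.mul_assoc, ← Matrix.mul_assoc (J n), J_mul_J]
    simp [Matrix.mul_assoc]
  have h2 : (J n * (C t * y t))ᴴ * (rot V * J n) = -((y t)ᴴ * (rot V * C t)ᴴ) := by
    rw [Matrix.conjTranspose_mul, conjTranspose_J, Matrix.mul_neg, Matrix.neg_mul,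
      Matrix.mul_assoc, ← Matrix.mul_assoc (J n), J_mul_rot_mul_J, Matrix.conjTranspose_mul,
      Matrix.conjTranspose_mul, Matrix.mul_assoc]
  rw [Matrix.conjTranspose_neg, Matrix.neg_mul, h2, Matrix.mul_neg,
    Matrix.mul_assoc _ (rot V * J n), h1, Matrix.mul_neg]
  simp only [neg_neg, Matrix.mul_add, Matrix.add_mul, Matrix.mul_assoc]
  abel

end Solutions

end HamiltonianSystem


/-! ### Quadratic forms -/

section Forms

variable {ι k m : Type*} [Fintype ι]

open scoped MatrixOrder in
theorem exists_eq_conjTranspose_mul_self {A : Matrix ι ι ℂ} (hA : A.PosSemidef) :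
    ∃ L : Matrix ι ι ℂ, A = Lᴴ * L := by
  classical
  exact (CStarAlgebra.nonneg_iff_eq_star_mul_self (a := A)).1 hA.nonneg

theorem re_conjTranspose_mul_self_apply (L : Matrix ι k ℂ) (i : k) :
    ((Lᴴ * L) i i).re = ∑ x, ‖L x i‖ ^ 2 := by
  rw [Matrix.mul_apply, Complex.re_sum]
  refine Finset.sum_congr rfl fun x _ => ?_
  rw [Matrix.conjTranspose_apply, Complex.star_def, ← Complex.normSq_eq_conj_mul_self,
    Complex.ofReal_re, Complex.normSq_eq_norm_sq]

theorem re_conjTranspose_mul_mul_apply_nonneg {A : Matrix ι ι ℂ} (hA : A.PosSemidef)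
    (z : Matrix ι k ℂ) (i : k) : 0 ≤ ((zᴴ * A * z) i i).re := by
  obtain ⟨L, rfl⟩ := exists_eq_conjTranspose_mul_self hA
  have : zᴴ * (Lᴴ * L) * z = (L * z)ᴴ * (L * z) := by
    simp only [Matrix.conjTranspose_mul, Matrix.mul_assoc]
  rw [this, re_conjTranspose_mul_self_apply]
  positivity

/-- The Cauchy-Schwarz inequality, in additive form. -/
theorem norm_conjTranspose_mul_mul_apply_le {A : Matrix ι ι ℂ} (hA : A.PosSemidef)
    (z : Matrix ι k ℂ) (y : Matrix ι m ℂ) (i : k) (j : m) {κ : ℝ} (hκ : 0 < κ) :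
    ‖(zᴴ * A * y) i j‖ ≤
      (κ * ((zᴴ * A * z) i i).re + κ⁻¹ * ((yᴴ * A * y) j j).re) / 2 := by
  obtain ⟨L, rfl⟩ := exists_eq_conjTranspose_mul_self hA
  have h1 : zᴴ * (Lᴴ * L) * z = (L * z)ᴴ * (L * z) := by
    simp only [Matrix.conjTranspose_mul, Matrix.mul_assoc]
  have h2 : yᴴ * (Lᴴ * L) * y = (L * y)ᴴ * (L * y) := by
    simp only [Matrix.conjTranspose_mul, Matrix.mul_assoc]
  have h3 : zᴴ * (Lᴴ * L) * y = (L * z)ᴴ * (L * y) := by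
    simp only [Matrix.conjTranspose_mul, Matrix.mul_assoc]
  rw [h1, h2, h3, re_conjTranspose_mul_self_apply, re_conjTranspose_mul_self_apply,
    Matrix.mul_apply, Finset.mul_sum, Finset.mul_sum, ← Finset.sum_add_distrib, Finset.sum_div]
  refine norm_sum_le_of_le _ fun x _ => ?_
  rw [norm_mul, Matrix.conjTranspose_apply, norm_star]
  have h4 : κ * κ⁻¹ = 1 := mul_inv_cancel₀ hκ.ne'
  have h5 : 0 < κ⁻¹ := inv_pos.2 hκ
  have h6 : 0 ≤ κ⁻¹ * (κ * ‖(L * z) x i‖ - ‖(L * y) x j‖) ^ 2 := by positivity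
  have h7 : κ⁻¹ * (κ * ‖(L * z) x i‖ - ‖(L * y) x j‖) ^ 2 =
      κ * ‖(L * z) x i‖ ^ 2 + κ⁻¹ * ‖(L * y) x j‖ ^ 2 - 2 * (‖(L * z) x i‖ * ‖(L * y) x j‖) := by
    field_simp
    ring
  linarith

theorem posSemidef_of_forall_col {M : Matrix ι ι ℂ} (hM : M.IsHermitian)
    (h : ∀ N : Matrix ι Unit ℂ, 0 ≤ ((Nᴴ * M * N) () ()).re) : M.PosSemidef := by
  refine Matrix.PosSemidef.of_dotProduct_mulVec_nonneg hM fun x => ?_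
  have h1 := h (Matrix.replicateCol Unit x)
  have h2 : ((Matrix.replicateCol Unit x)ᴴ * M * Matrix.replicateCol Unit x) () () =
      star x ⬝ᵥ M *ᵥ x := by
    rw [Matrix.mul_assoc]
    rfl
  rw [h2] at h1
  have h3 := hM.im_star_dotProduct_mulVec_self x
  rw [Complex.le_def]
  exact ⟨h1, h3.symm⟩

end Forms

/-! ### Densities, forms and energy estimates -/

namespace HamiltonianSystem

variable {n : ℕ} (S : HamiltonianSystem n)

theorem posSemidef_A {t : ℝ} (ht : t ∈ S.T) : (S.A t).PosSemidef := S.nonneg t ht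

/-- The density `y* A y` of the `j`-th column of `y`. -/
noncomputable def density {m : Type*} (y : ℝ → Matrix (Fin n ⊕ Fin n) m ℂ) (j : m) (t : ℝ) : ℝ :=
  (((y t)ᴴ * S.A t * y t) j j).re

/-- The form `ŷ* V₂ₙ J ŷ` of the `j`-th column of `y`. -/
noncomputable def form {m : Type*} (V : Matrix (Fin n) (Fin n) ℂ)
    (y : ℝ → Matrix (Fin n ⊕ Fin n) m ℂ) (j : m) (t : ℝ) : ℝ :=
  (((S.hat y t)ᴴ * (rot V * J n) * S.hat y t) j j).re

theorem tendsto_toInfty : Tendsto (fun t : ℝ => t) S.toInfty atTop :=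
  tendsto_id.mono_left inf_le_left

theorem eventually_mem_toInfty : ∀ᶠ t in S.toInfty, t ∈ S.T :=
  mem_inf_of_right (mem_principal_self _)

theorem eventually_ge_toInfty (a : ℝ) : ∀ᶠ t in S.toInfty, a ≤ t :=
  S.tendsto_toInfty.eventually_ge_atTop a

instance : S.toInfty.NeBot := by
  refine inf_principal_neBot_iff.2 fun U hU => ?_
  obtain ⟨a, ha⟩ := mem_atTop_sets.1 hU
  obtain ⟨s, hs, h⟩ := S.isSturmian.exists_gt (max a S.t₀)
  exact ⟨s, ha s ((le_max_left _ _).trans h.le), hs, (le_max_right _ _).trans h.le⟩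

instance : S.toInfty.IsCountablyGenerated := by
  unfold toInfty
  infer_instance

section Estimates

variable {S} {m k : Type*} {C E : ℝ → Mat2 n} {y : ℝ → Matrix (Fin n ⊕ Fin n) m ℂ}
  {z : ℝ → Matrix (Fin n ⊕ Fin n) k ℂ}

theorem density_nonneg {t : ℝ} (ht : t ∈ S.T) (y : ℝ → Matrix (Fin n ⊕ Fin n) m ℂ) (j : m) :
    0 ≤ S.density y j t :=
  re_conjTranspose_mul_mul_apply_nonneg (S.posSemidef_A ht) _ _

theorem continuousOn_conjTranspose_mul_mul {M : ℝ → Mat2 n} {s : Set ℝ} (hz : ContinuousOn z s)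
    (hM : ContinuousOn M s) (hy : ContinuousOn y s) (i : k) (j : m) :
    ContinuousOn (fun t => ((z t)ᴴ * M t * y t) i j) s := by
  have : Continuous fun p : Matrix (Fin n ⊕ Fin n) k ℂ × Mat2 n × Matrix (Fin n ⊕ Fin n) m ℂ =>
      (p.1ᴴ * p.2.1 * p.2.2) i j :=
    (((continuous_fst.matrix_conjTranspose).matrix_mul continuous_snd.fst).matrix_mul
      continuous_snd.snd).matrix_elem i j
  exact this.comp_continuousOn (f := fun t => (z t, M t, y t)) (hz.prodMk (hM.prodMk hy))

theorem continuousOn_density (hy : ContinuousOn y S.T) (j : m) :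
    ContinuousOn (S.density y j) S.T :=
  Complex.continuous_re.comp_continuousOn
    (continuousOn_conjTranspose_mul_mul hy S.continuousOn_A hy j j)

theorem hasDeltaDeriv_apply {F : ℝ → Matrix k m ℂ} {d : Matrix k m ℂ} {t : ℝ}
    (h : HasDeltaDeriv S.X S.t₀ F d t) (i : k) (j : m) :
    HasDeltaDeriv S.X S.t₀ (fun s => F s i j) (d i j) t :=
  ((continuous_id.matrix_elem i j).tendsto d).comp h

theorem hasDeltaDeriv_re {F : ℝ → ℂ} {d : ℂ} {t : ℝ} (h : HasDeltaDeriv S.X S.t₀ F d t) :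
    HasDeltaDeriv S.X S.t₀ (fun s => (F s).re) d.re t := by
  refine ((Complex.continuous_re.tendsto d).comp h).congr fun s => ?_
  simp only [Function.comp, Complex.smul_re, Complex.sub_re, smul_eq_mul]

/-- Integrates the energy identity. The case `δ = 0` is allowed and gives monotonicity of the form;
`δ > 0` gives square integrability. -/
theorem two_mul_integral_density_le (hy : S.IsSolution C y) (hC : ContinuousOn C S.T)
    {V : Matrix (Fin n) (Fin n) ℂ} {δ : ℝ}
    (hpos : ∀ t ∈ S.T, (rePart (rot V * C t) - δ • S.A t).PosSemidef) {a b : ℝ} (ha : a ∈ S.T)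
    (hb : b ∈ S.T) (hab : a ≤ b) (j : m) :
    2 * δ * ∫ x in a..b, S.density y j (retract S.X S.t₀ x) ≤ S.form V y j b - S.form V y j a := by
  have h := S.isSturmian
  have hyc := hy.continuousOn
  have hRC : ContinuousOn (fun t => rot V * C t) S.T :=
    (continuous_const.matrix_mul continuous_id).comp_continuousOn hC
  have hRC' : ContinuousOn (fun t => rot V * C t + (rot V * C t)ᴴ) S.T :=
    hRC.add (continuous_id.matrix_conjTranspose.comp_continuousOn hRC)
  have hc : ContinuousOn
      (fun t => (((y t)ᴴ * (rot V * C t + (rot V * C t)ᴴ) * y t) j j).re) S.T :=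
    Complex.continuous_re.comp_continuousOn (continuousOn_conjTranspose_mul_mul hyc hRC' hyc j j)
  rw [← h.integral_eq_sub hc (F := S.form V y j) (fun t ht => hasDeltaDeriv_re
    (hasDeltaDeriv_apply (hy.hasDeltaDeriv_rot V ht) j j)) ha hb,
    ← intervalIntegral.integral_const_mul]
  refine intervalIntegral.integral_mono_on hab
    ((h.intervalIntegrable (continuousOn_density hyc j) ha.2 hb.2).const_mul _)
    (h.intervalIntegrable hc ha.2 hb.2) fun x hx => ?_
  have hr := h.retract_mem (ha.2.trans hx.1)
  have h1 := re_conjTranspose_mul_mul_apply_nonneg (hpos _ hr) (y (retract S.X S.t₀ x)) j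
  rw [density, rePart] at *
  simp only [Matrix.mul_sub, Matrix.sub_mul, Matrix.mul_smul, Matrix.smul_mul, Matrix.sub_apply,
    Matrix.smul_apply, Complex.sub_re, Complex.real_smul, Complex.re_ofReal_mul, smul_eq_mul] at h1
  rw [show (1 / 2 : ℂ) = ((1 / 2 : ℝ) : ℂ) by norm_num, Complex.re_ofReal_mul] at h1
  linarith

/-- A form that stays nonpositive can grow by at most the negative of its initial value, which
bounds the integrals over all `[t₀, b]`. -/
theorem integrableOn_density (hy : S.IsSolution C y) (hC : ContinuousOn C S.T)
    {V : Matrix (Fin n) (Fin n) ℂ} {δ : ℝ} (hδ : 0 < δ)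
    (hpos : ∀ t ∈ S.T, (rePart (rot V * C t) - δ • S.A t).PosSemidef) (j : m)
    (hneg : ∀ t ∈ S.T, S.form V y j t ≤ 0) :
    IntegrableOn (fun x => S.density y j (retract S.X S.t₀ x)) (Set.Ioi S.t₀) := by
  have h := S.isSturmian
  have hc := continuousOn_density hy.continuousOn j
  refine integrableOn_Ioi_of_intervalIntegral_norm_bounded (l := S.toInfty) (b := fun t => t)
    (-S.form V y j S.t₀ / (2 * δ)) S.t₀ (fun b => ?_) S.tendsto_toInfty ?_
  · rcases le_total S.t₀ b with hb | hb
    · exact (h.intervalIntegrable hc le_rfl hb).1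
    · rw [Set.Ioc_eq_empty (not_lt.2 hb)]
      exact integrableOn_empty
  · filter_upwards [S.eventually_mem_toInfty] with b hb
    have h1 := two_mul_integral_density_le hy hC hpos h.start_mem hb hb.2 j
    have h2 : ∫ x in S.t₀..b, ‖S.density y j (retract S.X S.t₀ x)‖ =
        ∫ x in S.t₀..b, S.density y j (retract S.X S.t₀ x) := by
      refine intervalIntegral.integral_congr fun x hx => ?_
      rw [Set.uIcc_of_le hb.2] at hx
      exact Real.norm_of_nonneg (density_nonneg (h.retract_mem hx.1) y j)
    rw [h2, le_div_iff₀' (by positivity)]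
    linarith [hneg b hb]

/-! ### The Lagrange identity -/

variable {w ν : ℂ}

theorem hasDeltaDeriv_pairing (hy : S.IsSolution (fun t => w • S.A t + S.B t) y)
    (hz : S.IsSolution (fun t => conj ν • S.A t + (S.B t)ᴴ) z) {t : ℝ} (ht : t ∈ S.T) :
    HasDeltaDeriv S.X S.t₀ (fun s => (S.hat z s)ᴴ * J n * S.hat y s)
      ((w - ν) • ((z t)ᴴ * S.A t * y t)) t := by
  convert hy.hasDeltaDeriv_J hz ht using 1
  rw [Matrix.conjTranspose_add, Matrix.conjTranspose_smul, Matrix.conjTranspose_conjTranspose,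
    (S.posSemidef_A ht).isHermitian.eq, Complex.star_def, Complex.conj_conj,
    add_sub_add_right_eq_sub, ← sub_smul, Matrix.mul_smul, Matrix.smul_mul]

theorem pairing_sub_pairing (hy : S.IsSolution (fun t => w • S.A t + S.B t) y)
    (hz : S.IsSolution (fun t => conj ν • S.A t + (S.B t)ᴴ) z) {a b : ℝ} (ha : a ∈ S.T)
    (hb : b ∈ S.T) (i : k) (j : m) :
    ((S.hat z b)ᴴ * J n * S.hat y b) i j - ((S.hat z a)ᴴ * J n * S.hat y a) i j =
      (w - ν) * ∫ x in a..b, ((z (retract S.X S.t₀ x))ᴴ * S.A (retract S.X S.t₀ x) *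
        y (retract S.X S.t₀ x)) i j := by
  rw [← intervalIntegral.integral_const_mul]
  have hc : ContinuousOn (fun t => (w - ν) * ((z t)ᴴ * S.A t * y t) i j) S.T :=
    (continuousOn_conjTranspose_mul_mul hz.continuousOn S.continuousOn_A hy.continuousOn i
      j).const_mul _
  exact (S.isSturmian.integral_eq_sub hc (F := fun s => ((S.hat z s)ᴴ * J n * S.hat y s) i j)
    (fun t ht => hasDeltaDeriv_apply (hasDeltaDeriv_pairing hy hz ht) i j) ha hb).symm

theorem pairing_eq (hy : S.IsSolution (fun t => w • S.A t + S.B t) y)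
    (hz : S.IsSolution (fun t => conj w • S.A t + (S.B t)ᴴ) z) {t : ℝ} (ht : t ∈ S.T) :
    (S.hat z t)ᴴ * J n * S.hat y t = (S.hat z S.t₀)ᴴ * J n * S.hat y S.t₀ := by
  ext i j
  rw [← sub_eq_zero, pairing_sub_pairing hy hz S.isSturmian.start_mem ht, sub_self, zero_mul]

theorem norm_pairing_sub_le (hy : S.IsSolution (fun t => w • S.A t + S.B t) y)
    (hz : S.IsSolution (fun t => conj ν • S.A t + (S.B t)ᴴ) z) {a b : ℝ} (ha : a ∈ S.T)
    (hb : b ∈ S.T) (hab : a ≤ b) (i : k) (j : m) {κ : ℝ} (hκ : 0 < κ) :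
    ‖((S.hat z b)ᴴ * J n * S.hat y b) i j - ((S.hat z a)ᴴ * J n * S.hat y a) i j‖ ≤
      ‖w - ν‖ * ((κ * (∫ x in a..b, S.density z i (retract S.X S.t₀ x)) +
        κ⁻¹ * ∫ x in a..b, S.density y j (retract S.X S.t₀ x)) / 2) := by
  have h := S.isSturmian
  rw [pairing_sub_pairing hy hz ha hb, norm_mul]
  refine mul_le_mul_of_nonneg_left ?_ (norm_nonneg _)
  have h1 := (h.intervalIntegrable (continuousOn_density hz.continuousOn i) ha.2 hb.2).const_mul κ
  have h2 := (h.intervalIntegrable (continuousOn_density hy.continuousOn j) ha.2 hb.2).const_mul κ⁻¹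
  rw [← intervalIntegral.integral_const_mul, ← intervalIntegral.integral_const_mul,
    ← intervalIntegral.integral_add h1 h2, ← intervalIntegral.integral_div]
  refine intervalIntegral.norm_integral_le_of_norm_le hab (ae_of_all _ fun x hx => ?_)
    ((h1.add h2).div_const 2)
  exact norm_conjTranspose_mul_mul_apply_le (S.posSemidef_A (h.retract_mem (ha.2.trans hx.1.le)))
    _ _ i j hκ

/-- The integrated Lagrange identity with the upper end sent to infinity. Absolute convergence is
Cauchy-Schwarz with `κ = 1`, and the result moves to the delta measure because that is the image of
Lebesgue measure under the retraction. -/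
theorem hasDeltaIntegral_of_tendsto {y z : ℝ → Col2 n}
    (hy : S.IsSolution (fun t => w • S.A t + S.B t) y)
    (hz : S.IsSolution (fun t => conj ν • S.A t + (S.B t)ᴴ) z)
    (hyi : ∀ j, IntegrableOn (fun x => S.density y j (retract S.X S.t₀ x)) (Set.Ioi S.t₀))
    (hzi : ∀ i, IntegrableOn (fun x => S.density z i (retract S.X S.t₀ x)) (Set.Ioi S.t₀))
    (hlim : Tendsto (fun t => (S.hat z t)ᴴ * J n * S.hat y t) S.toInfty (𝓝 0)) :
    ∃ I, S.HasDeltaIntegral (fun t => (z t)ᴴ * S.A t * y t) I ∧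
      -((S.hat z S.t₀)ᴴ * J n * S.hat y S.t₀) = (w - ν) • I := by
  have h := S.isSturmian
  have hc : ∀ i j, ContinuousOn (fun t => ((z t)ᴴ * S.A t * y t) i j) S.T := fun i j =>
    continuousOn_conjTranspose_mul_mul hz.continuousOn S.continuousOn_A hy.continuousOn i j
  have hint : ∀ i j, IntegrableOn (fun x => ((z (retract S.X S.t₀ x))ᴴ * S.A (retract S.X S.t₀ x) *
        y (retract S.X S.t₀ x)) i j) (Set.Ioi S.t₀) := by
    intro i j
    refine Integrable.mono' (((hzi i).add (hyi j)).div_const 2)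
      ((h.aestronglyMeasurable_comp_retract (hc i j)).mono_set Set.Ioi_subset_Ici_self) ?_
    filter_upwards [ae_restrict_mem measurableSet_Ioi] with x hx
    have := norm_conjTranspose_mul_mul_apply_le
      (S.posSemidef_A (h.retract_mem (le_of_lt (Set.mem_Ioi.1 hx))))
      (z (retract S.X S.t₀ x)) (y (retract S.X S.t₀ x)) i j one_pos
    simpa [density] using this
  refine ⟨Matrix.of fun i j => ∫ t, ((z t)ᴴ * S.A t * y t) i j ∂(deltaMeasure S.X S.t₀),
    fun i j => ⟨?_, rfl⟩, ?_⟩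
  · rw [deltaMeasure, integrable_map_measure (h.aestronglyMeasurable_of_continuousOn (hc i j))
      (aemeasurable_retract h.mem)]
    exact (integrableOn_Ici_iff_integrableOn_Ioi).2 (hint i j)
  · ext i j
    have h1 : ∫ t, ((z t)ᴴ * S.A t * y t) i j ∂(deltaMeasure S.X S.t₀) =
        ∫ x in Set.Ioi S.t₀, ((z (retract S.X S.t₀ x))ᴴ * S.A (retract S.X S.t₀ x) *
          y (retract S.X S.t₀ x)) i j := by
      rw [deltaMeasure, integral_map (aemeasurable_retract h.mem)
        (h.aestronglyMeasurable_of_continuousOn (hc i j)), integral_Ici_eq_integral_Ioi]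
    rw [Matrix.smul_apply, Matrix.of_apply, h1, smul_eq_mul, Matrix.neg_apply]
    have h2 := (intervalIntegral_tendsto_integral_Ioi S.t₀ (hint i j)
      S.tendsto_toInfty).const_mul (w - ν)
    have h3 : Tendsto (fun t => ((S.hat z t)ᴴ * J n * S.hat y t) i j -
        ((S.hat z S.t₀)ᴴ * J n * S.hat y S.t₀) i j) S.toInfty
        (𝓝 (0 - ((S.hat z S.t₀)ᴴ * J n * S.hat y S.t₀) i j)) :=
      (((continuous_id.matrix_elem i j).tendsto 0).comp hlim).sub_const _
    rw [zero_sub] at h3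
    refine tendsto_nhds_unique h3 (h2.congr' ?_)
    filter_upwards [S.eventually_mem_toInfty] with t ht
    exact (pairing_sub_pairing hy hz h.start_mem ht i j).symm

end Estimates

end HamiltonianSystem


/-! ### Nonpositive subspaces -/

section LinearAlgebra

variable {ι : Type*} [Fintype ι] [DecidableEq ι]

/-- `1 - K*K` and `1 - KK*` are the two Schur complements of the block matrix `(1, K; K*, 1)`. -/
theorem posSemidef_one_sub_mul_conjTranspose {K : Matrix ι ι ℂ} (h : (1 - Kᴴ * K).PosSemidef) :
    (1 - K * Kᴴ).PosSemidef := by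
  let _ : Invertible (1 : Matrix ι ι ℂ) := invertibleOne
  have h1 := Matrix.PosDef.fromBlocks₁₁ K (1 : Matrix ι ι ℂ) Matrix.PosDef.one
  have h2 := Matrix.PosDef.fromBlocks₂₂ (1 : Matrix ι ι ℂ) K Matrix.PosDef.one
  simp only [inv_one, Matrix.mul_one] at h1 h2
  exact h2.1 (h1.2 h)

theorem isUnit_of_forall_mulVec {M : Matrix ι ι ℂ} (h : ∀ v, M *ᵥ v = 0 → v = 0) : IsUnit M := by
  rw [← Matrix.mulVec_injective_iff_isUnit]
  intro v w hvw
  refine sub_eq_zero.1 (h _ ?_)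
  rw [Matrix.mulVec_sub]
  exact sub_eq_zero.2 hvw

/-- A Cayley transform turns the nonnegative pair `(a, b)` into the contraction `K = (a - b)(a +
b)⁻¹`. The relation between the pairs says that `(c, d)` is governed by `-K*` in the same way, and
`K*` is again a contraction. -/
theorem posSemidef_add_of_mul_eq_mul {a b c d : Matrix ι ι ℂ} (hab : (aᴴ * b + bᴴ * a).PosSemidef)
    (hinj : ∀ v, a *ᵥ v = 0 → b *ᵥ v = 0 → v = 0) (h : dᴴ * a = cᴴ * b) :
    (cᴴ * d + dᴴ * c).PosSemidef := by
  have hsub : (2 : ℝ) • (aᴴ * b + bᴴ * a) = (a + b)ᴴ * (a + b) - (a - b)ᴴ * (a - b) := by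
    simp only [Matrix.conjTranspose_add, Matrix.conjTranspose_sub, Matrix.add_mul, Matrix.mul_add,
      Matrix.sub_mul, Matrix.mul_sub, two_smul]
    abel
  -- By `hsub`, a kernel vector of `a + b` is also killed by `a - b`, hence by both `a` and `b`.
  have hunit : IsUnit (a + b) := by
    refine isUnit_of_forall_mulVec fun v hv => ?_
    have h1 := (hab.smul (zero_le_two (α := ℝ))).re_dotProduct_nonneg v
    rw [hsub, Matrix.sub_mulVec, ← Matrix.mulVec_mulVec, hv, Matrix.mulVec_zero, zero_sub,
      dotProduct_neg, ← Matrix.mulVec_mulVec, Matrix.dotProduct_mulVec, ← Matrix.star_mulVec] at h1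
    have h2 : (a - b) *ᵥ v = 0 := by
      rw [← dotProduct_star_self_eq_zero]
      have h3 : 0 ≤ star ((a - b) *ᵥ v) ⬝ᵥ (a - b) *ᵥ v := dotProduct_star_self_nonneg _
      rw [Complex.le_def] at h3
      simp only [map_neg] at h1
      exact Complex.ext (le_antisymm (by simpa using h1) h3.1) h3.2.symm
    rw [Matrix.add_mulVec] at hv
    rw [Matrix.sub_mulVec] at h2
    have h3 : b *ᵥ v = a *ᵥ v := (sub_eq_zero.1 h2).symm
    rw [h3, ← two_smul ℂ, smul_eq_zero] at hv
    have h4 := hv.resolve_left two_ne_zero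
    exact hinj v h4 (h3.trans h4)
  have hdet := (Matrix.isUnit_iff_isUnit_det _).1 hunit
  set K := (a - b) * (a + b)⁻¹ with hK
  have hKg : K * (a + b) = a - b := by
    rw [hK, Matrix.mul_assoc, Matrix.nonsing_inv_mul _ hdet, Matrix.mul_one]
  clear_value K
  have h1 : (1 - Kᴴ * K).PosSemidef := by
    have h2 := (hab.smul (zero_le_two (α := ℝ))).conjTranspose_mul_mul_same (a + b)⁻¹
    rw [hsub, ← hKg] at h2
    convert h2 using 1
    have h3 : (a + b) * (a + b)⁻¹ = 1 := Matrix.mul_nonsing_inv _ hdet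
    have h4 : (a + b)⁻¹ᴴ * (a + b)ᴴ = 1 := by
      rw [← Matrix.conjTranspose_mul, h3, Matrix.conjTranspose_one]
    rw [Matrix.mul_sub, Matrix.sub_mul, Matrix.conjTranspose_mul]
    congr 1
    · rw [← Matrix.mul_assoc, h4, Matrix.one_mul, h3]
    · rw [← Matrix.mul_assoc, ← Matrix.mul_assoc, ← Matrix.mul_assoc, h4, Matrix.one_mul,
        Matrix.mul_assoc _ _ (a + b)⁻¹, h3, Matrix.mul_one]
  have h5 : (d - c)ᴴ = -((d + c)ᴴ * K) := by
    have h6 : (d - c)ᴴ * (a + b) = -((d + c)ᴴ * K) * (a + b) := by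
      rw [Matrix.neg_mul, Matrix.mul_assoc, hKg]
      simp only [Matrix.conjTranspose_add, Matrix.conjTranspose_sub, Matrix.add_mul, Matrix.mul_add,
        Matrix.sub_mul, Matrix.mul_sub, h]
      abel
    exact hunit.mul_right_cancel h6
  have h7 : cᴴ * d + dᴴ * c = (1 / 2 : ℝ) • ((d + c)ᴴ * (1 - K * Kᴴ) * (d + c)) := by
    have h8 : (d - c) = -(Kᴴ * (d + c)) := by
      have := congrArg Matrix.conjTranspose h5
      simpa only [Matrix.conjTranspose_conjTranspose, Matrix.conjTranspose_neg,
        Matrix.conjTranspose_mul] using this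
    have h9 : (d + c)ᴴ * (1 - K * Kᴴ) * (d + c) = (d + c)ᴴ * (d + c) - (d - c)ᴴ * (d - c) := by
      rw [h5, h8]
      simp only [Matrix.mul_sub, Matrix.sub_mul, Matrix.mul_one, Matrix.neg_mul, Matrix.mul_neg,
        neg_neg, Matrix.mul_assoc]
    have h10 : (d + c)ᴴ * (d + c) - (d - c)ᴴ * (d - c) = (2 : ℝ) • (cᴴ * d + dᴴ * c) := by
      simp only [Matrix.conjTranspose_add, Matrix.conjTranspose_sub, Matrix.add_mul, Matrix.mul_add,
        Matrix.sub_mul, Matrix.mul_sub, two_smul]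
      abel
    rw [h9, h10, smul_smul]
    norm_num
  rw [h7]
  exact ((posSemidef_one_sub_mul_conjTranspose h1).conjTranspose_mul_mul_same _).smul (by norm_num)

/-- The injective `p` spans an `n`-dimensional, hence maximal, nonpositive subspace; its
`J`-orthogonal complement is nonpositive for the form of `V⁻¹`. With `p = (a, b)` and `q = (c, d)`
this is the preceding lemma for the pairs `(a, V b)` and `(V⁻* c, d)`. -/
theorem posSemidef_dual {n : ℕ} {V : Matrix (Fin n) (Fin n) ℂ} (hV : IsUnit V) {p q : Col2 n}
    (hp : ∀ v, p *ᵥ v = 0 → v = 0) (hneg : (-(pᴴ * (rot V * J n) * p)).PosSemidef)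
    (hq : qᴴ * J n * p = 0) : (-(qᴴ * (rot V⁻¹ * J n) * q)).PosSemidef := by
  obtain ⟨a, b, rfl⟩ : ∃ a b, p = Matrix.fromRows a b := ⟨_, _, (Matrix.fromRows_toRows _).symm⟩
  obtain ⟨c, d, rfl⟩ : ∃ a b, q = Matrix.fromRows a b := ⟨_, _, (Matrix.fromRows_toRows _).symm⟩
  have hdet := (Matrix.isUnit_iff_isUnit_det _).1 hV
  rw [rot_mul_J, conjTranspose_fromRows_mul_mul] at hneg ⊢
  rw [J, conjTranspose_fromRows_mul_mul] at hq
  have h1 : (aᴴ * (V * b) + (V * b)ᴴ * a).PosSemidef := by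
    simpa [Matrix.conjTranspose_mul, Matrix.mul_assoc, add_comm] using hneg
  have h2 := posSemidef_add_of_mul_eq_mul (c := V⁻¹ᴴ * c) (d := d) h1 (fun v hv hw => ?_) ?_
  · simpa [Matrix.conjTranspose_mul, Matrix.mul_assoc, add_comm] using h2
  · refine hp v ?_
    rw [Matrix.fromRows_mulVec, hv]
    have : b *ᵥ v = V⁻¹ *ᵥ ((V * b) *ᵥ v) := by
      rw [Matrix.mulVec_mulVec, ← Matrix.mul_assoc, Matrix.nonsing_inv_mul _ hdet, Matrix.one_mul]
    rw [this, hw, Matrix.mulVec_zero]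
    ext i
    cases i <;> rfl
  · rw [Matrix.conjTranspose_mul, Matrix.conjTranspose_conjTranspose, Matrix.mul_assoc,
      ← Matrix.mul_assoc V⁻¹, Matrix.nonsing_inv_mul _ hdet, Matrix.one_mul]
    simp only [Matrix.neg_mul, Matrix.one_mul, Matrix.mul_neg] at hq
    exact (neg_add_eq_zero.1 hq).symm

-- Compactness of the unit sphere: if no `Q t` were positive definite, the sets of unit vectors with
-- nonpositive form would be nonempty, closed and decreasing in `t`, and so would share a point.
omit [DecidableEq ι] in
theorem exists_posDef_of_directed {T : Type*} [LinearOrder T] [Nonempty T]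
    (Q : T → Matrix ι ι ℂ) (hH : ∀ t, (Q t).IsHermitian)
    (hmono : ∀ s t, s ≤ t → (Q t - Q s).PosSemidef)
    (h : ∀ x, (∀ t, (star x ⬝ᵥ Q t *ᵥ x).re ≤ 0) → x = 0) : ∃ t, (Q t).PosDef := by
  by_contra! hc
  have hcont : ∀ t, Continuous fun x : ι → ℂ => (star x ⬝ᵥ Q t *ᵥ x).re := fun t =>
    Complex.continuous_re.comp
      (continuous_star.dotProduct (continuous_const.matrix_mulVec continuous_id))
  have hclosed : ∀ t, IsClosed {x : ι → ℂ | (star x ⬝ᵥ Q t *ᵥ x).re ≤ 0} := fun t =>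
    isClosed_le (hcont t) continuous_const
  have hcomp : IsCompact (Metric.sphere (0 : ι → ℂ) 1) := isCompact_sphere _ _
  have hne : (⋂ t, Metric.sphere (0 : ι → ℂ) 1 ∩
      {x : ι → ℂ | (star x ⬝ᵥ Q t *ᵥ x).re ≤ 0}).Nonempty := by
    refine IsCompact.nonempty_iInter_of_directed_nonempty_isCompact_isClosed _
      (fun s t => ⟨max s t, ?_, ?_⟩) (fun t => ?_) (fun t => hcomp.inter_right (hclosed t))
      (fun t => Metric.isClosed_sphere.inter (hclosed t))
    · rintro x ⟨hx, hx'⟩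
      refine ⟨hx, ?_⟩
      have := (hmono s _ (le_max_left s t)).re_dotProduct_nonneg x
      rw [Matrix.sub_mulVec, dotProduct_sub] at this
      simp only [map_sub, RCLike.re_eq_complex_re, Set.mem_ofPred_eq] at this hx' ⊢
      linarith
    · rintro x ⟨hx, hx'⟩
      refine ⟨hx, ?_⟩
      have := (hmono t _ (le_max_right s t)).re_dotProduct_nonneg x
      rw [Matrix.sub_mulVec, dotProduct_sub] at this
      simp only [map_sub, RCLike.re_eq_complex_re, Set.mem_ofPred_eq] at this hx' ⊢
      linarith
    · by_contra hne
      refine hc t (Matrix.PosDef.of_dotProduct_mulVec_pos (hH t) fun x hx => ?_)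
      rw [Complex.lt_def]
      refine ⟨?_, ((hH t).im_star_dotProduct_mulVec_self x).symm⟩
      by_contra! hle
      refine hne ⟨(‖x‖⁻¹ : ℝ) • x, ?_, ?_⟩
      · rw [mem_sphere_zero_iff_norm, norm_smul, norm_inv, norm_norm,
          inv_mul_cancel₀ (norm_ne_zero_iff.2 hx)]
      · rw [Set.mem_ofPred_eq, star_smul, star_trivial, Matrix.mulVec_smul, smul_dotProduct,
          dotProduct_smul, Complex.smul_re, Complex.smul_re, smul_smul, smul_eq_mul]
        exact mul_nonpos_of_nonneg_of_nonpos (by positivity) hle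
  obtain ⟨x, hx⟩ := hne
  rw [Set.mem_iInter] at hx
  have h1 := h x fun t => (hx t).2
  have h2 := (hx (Classical.arbitrary T)).1
  rw [h1] at h2
  simp at h2

/-- Vectors in the nonpositive cone cannot have a vanishing first block, so by compactness that
block has norm at least `a ‖v‖` with some `a > 0`. For a column `v` of `(1; l)` the first block is a
standard basis vector, whence `‖v‖ ≤ a⁻¹`. -/
theorem exists_bound_of_posDef {n : ℕ} {G : Mat2 n} (hG : (G.toBlocks₂₂).PosDef) :
    ∃ C : ℝ, ∀ l : Matrix (Fin n) (Fin n) ℂ,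
      (-((Matrix.fromRows 1 l : Col2 n)ᴴ * G * (Matrix.fromRows 1 l : Col2 n))).PosSemidef →
        ∀ i j, ‖l i j‖ ≤ C := by
  set q : (Fin n ⊕ Fin n → ℂ) → ℝ := fun v => (star v ⬝ᵥ G *ᵥ v).re with hq
  have hqc : Continuous q := Complex.continuous_re.comp
    (continuous_star.dotProduct (continuous_const.matrix_mulVec continuous_id))
  have hK : IsCompact (Metric.sphere (0 : Fin n ⊕ Fin n → ℂ) 1 ∩ {v | q v ≤ 0}) :=
    (isCompact_sphere _ _).inter_right (isClosed_le hqc continuous_const)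
  have hf : Continuous fun v : Fin n ⊕ Fin n → ℂ => ‖fun i => v (Sum.inl i)‖ := by fun_prop
  have hpos : ∀ v ∈ Metric.sphere (0 : Fin n ⊕ Fin n → ℂ) 1 ∩ {v | q v ≤ 0},
      0 < ‖fun i => v (Sum.inl i)‖ := by
    intro v hv
    refine norm_pos_iff.2 fun h0 => ?_
    have hv2 : (fun i => v (Sum.inr i)) ≠ 0 := by
      intro h1
      have : v = 0 := by
        ext i
        cases i with
        | inl i => exact congrFun h0 i
        | inr i => exact congrFun h1 i
      rw [this] at hv
      simpa using hv.1
    have h2 := hG.dotProduct_mulVec_pos hv2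
    have h3 : star v ⬝ᵥ G *ᵥ v =
        star (fun i => v (Sum.inr i)) ⬝ᵥ G.toBlocks₂₂ *ᵥ fun i => v (Sum.inr i) := by
      have h4 : ∀ i, v (Sum.inl i) = 0 := fun i => congrFun h0 i
      simp [dotProduct, Matrix.mulVec, Fintype.sum_sum_type, h4, Matrix.toBlocks₂₂]
    have h5 := hv.2
    simp only [Set.mem_ofPred_eq, hq, h3] at h5
    rw [Complex.lt_def] at h2
    exact absurd h2.1 (not_lt.2 h5)
  obtain ⟨a, ha, hle⟩ := hK.exists_forall_le' hf.continuousOn hpos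
  refine ⟨a⁻¹, fun l hl i j => ?_⟩
  set v : Fin n ⊕ Fin n → ℂ := (Matrix.fromRows 1 l : Col2 n).col j with hv
  have hv1 : ‖fun i => v (Sum.inl i)‖ ≤ 1 := by
    refine (pi_norm_le_iff_of_nonneg zero_le_one).2 fun i => ?_
    simp only [hv, Matrix.col_apply, Matrix.fromRows_apply_inl, Matrix.one_apply]
    split_ifs <;> simp
  have hv0 : v ≠ 0 := by
    intro h0
    have := congrFun h0 (Sum.inl j)
    simp [hv] at this
  have hqv : q v ≤ 0 := by
    have h1 := hl.diag_nonneg (i := j)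
    rw [Complex.le_def] at h1
    have h2 : ((Matrix.fromRows 1 l : Col2 n)ᴴ * G * (Matrix.fromRows 1 l : Col2 n)) j j =
        star v ⬝ᵥ G *ᵥ v := by
      rw [Matrix.mul_assoc]
      rfl
    rw [Matrix.neg_apply, h2] at h1
    simpa using h1.1
  have hvpos : 0 < ‖v‖ := norm_pos_iff.2 hv0
  have h3 := hle ((‖v‖⁻¹ : ℝ) • v) ⟨?_, ?_⟩
  · have h4 : ‖fun i => ((‖v‖⁻¹ : ℝ) • v) (Sum.inl i)‖ = ‖v‖⁻¹ * ‖fun i => v (Sum.inl i)‖ := by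
      have : (fun i => ((‖v‖⁻¹ : ℝ) • v) (Sum.inl i)) = (‖v‖⁻¹ : ℝ) • fun i => v (Sum.inl i) := rfl
      rw [this, norm_smul, norm_inv, norm_norm]
    rw [h4] at h3
    have h5 : a ≤ ‖v‖⁻¹ := h3.trans (mul_le_of_le_one_right (by positivity) hv1)
    have h6 : ‖l i j‖ ≤ ‖v‖ := norm_le_pi_norm v (Sum.inr i)
    exact h6.trans ((le_inv_comm₀ ha hvpos).1 h5)
  · rw [mem_sphere_zero_iff_norm, norm_smul, norm_inv, norm_norm, inv_mul_cancel₀ hvpos.ne']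
  · rw [Set.mem_ofPred_eq, hq]
    simp only [star_smul, star_trivial, Matrix.mulVec_smul, smul_dotProduct,
      dotProduct_smul, Complex.smul_re, smul_smul, smul_eq_mul]
    exact mul_nonpos_of_nonneg_of_nonpos (by positivity) hqv

/-- Write `P = Y (α; β)`. If `α v = 0`, then `P v` lies in the range of the last columns of `Y`,
where the form is positive definite, while it is nonpositive on `P v`; so `v = 0`. Thus `α` is
invertible and `l = β α⁻¹`. -/
theorem exists_mul_fromRows_eq {n : ℕ} {Y H : Mat2 n} {P : Col2 n} (hY : IsUnit Y)
    (hP : ∀ v, P *ᵥ v = 0 → v = 0) (hneg : (-(Pᴴ * H * P)).PosSemidef)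
    (hpos : (Y.toCols₂ᴴ * H * Y.toCols₂).PosDef) :
    ∃ l α : Matrix (Fin n) (Fin n) ℂ, IsUnit α ∧ Y * (Matrix.fromRows 1 l : Col2 n) * α = P := by
  have hdet := (Matrix.isUnit_iff_isUnit_det _).1 hY
  obtain ⟨α, β, hN⟩ : ∃ a b, Y⁻¹ * P = Matrix.fromRows a b :=
    ⟨_, _, (Matrix.fromRows_toRows _).symm⟩
  have hYN : Y * Matrix.fromRows α β = P := by
    rw [← hN, ← Matrix.mul_assoc, Matrix.mul_nonsing_inv _ hdet, Matrix.one_mul]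
  have hα : IsUnit α := by
    refine isUnit_of_forall_mulVec fun v hv => ?_
    have h1 : P *ᵥ v = Y.toCols₂ *ᵥ (β *ᵥ v) := by
      rw [← hYN]
      conv_lhs => rw [← Matrix.fromCols_toCols Y]
      rw [Matrix.fromCols_mul_fromRows, Matrix.add_mulVec, ← Matrix.mulVec_mulVec, hv,
        Matrix.mulVec_zero, zero_add, Matrix.mulVec_mulVec]
    have h2 := hneg.re_dotProduct_nonneg v
    have h3 : ∀ (R : Col2 n) (w : Fin n → ℂ), star w ⬝ᵥ (Rᴴ * H * R) *ᵥ w =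
        star (R *ᵥ w) ⬝ᵥ H *ᵥ (R *ᵥ w) := by
      intro R w
      rw [Matrix.mul_assoc, ← Matrix.mulVec_mulVec, Matrix.dotProduct_mulVec, ← Matrix.star_mulVec,
        ← Matrix.mulVec_mulVec]
    rw [Matrix.neg_mulVec, dotProduct_neg, h3, h1, ← h3] at h2
    have h4 : β *ᵥ v = 0 := by
      by_contra hne
      have h5 := hpos.dotProduct_mulVec_pos hne
      rw [Complex.lt_def] at h5
      simp only [map_neg, RCLike.re_eq_complex_re] at h2
      have := h5.1
      simp only [Complex.zero_re] at this
      linarith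
    rw [h4, Matrix.mulVec_zero] at h1
    exact hP v h1
  have hdα := (Matrix.isUnit_iff_isUnit_det _).1 hα
  refine ⟨β * α⁻¹, α, hα, ?_⟩
  rw [Matrix.mul_assoc, Matrix.fromRows_mul, Matrix.one_mul, Matrix.mul_assoc,
    Matrix.nonsing_inv_mul _ hdα, Matrix.mul_one, hYN]

end LinearAlgebra


theorem rePart_add {ι : Type*} (M N : Matrix ι ι ℂ) : rePart (M + N) = rePart M + rePart N := by
  rw [rePart, rePart, rePart, Matrix.conjTranspose_add, ← smul_add]
  congr 1
  abel

theorem rot_mul_rot_inv {n : ℕ} {U : Matrix (Fin n) (Fin n) ℂ} (hU : IsUnit U) :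
    rot U⁻¹ * rot U = 1 := by
  have hdet := (Matrix.isUnit_iff_isUnit_det _).1 hU
  rw [rot, rot, Matrix.fromBlocks_multiply, ← Matrix.fromBlocks_one]
  simp [Matrix.nonsing_inv_mul _ hdet, ← Matrix.conjTranspose_mul, Matrix.mul_nonsing_inv _ hdet]

theorem isClosed_posSemidef {ι : Type*} [Fintype ι] :
    IsClosed {M : Matrix ι ι ℂ | M.PosSemidef} := by
  have h1 : {M : Matrix ι ι ℂ | M.PosSemidef} =
      {M | Mᴴ = M} ∩ ⋂ x : ι → ℂ, {M | 0 ≤ star x ⬝ᵥ M *ᵥ x} := by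
    ext M
    simp only [Set.mem_inter_iff, Set.mem_iInter]
    exact Matrix.posSemidef_iff_dotProduct_mulVec
  rw [h1]
  refine (isClosed_eq continuous_id.matrix_conjTranspose continuous_id).inter
    (isClosed_iInter fun x => isClosed_le continuous_const ?_)
  exact continuous_const.dotProduct (continuous_id.matrix_mulVec continuous_const)

namespace HamiltonianSystem

variable {n : ℕ} (S : HamiltonianSystem n)

/-! ### Weyl solutions -/

theorem ψ_eq (z : ℂ) (l : Matrix (Fin n) (Fin n) ℂ) :
    S.ψ z l = fun t => S.Y z t * (Matrix.fromRows 1 l : Col2 n) := by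
  funext t
  conv_rhs => rw [← Matrix.fromCols_toCols (S.Y z t)]
  rw [Matrix.fromCols_mul_fromRows, Matrix.mul_one]
  rfl

theorem ζ_eq (z : ℂ) (l : Matrix (Fin n) (Fin n) ℂ) :
    S.ζ z l = fun t => S.Z z t * (Matrix.fromRows 1 lᴴ : Col2 n) := by
  funext t
  conv_rhs => rw [← Matrix.fromCols_toCols (S.Z z t)]
  rw [Matrix.fromCols_mul_fromRows, Matrix.mul_one]
  rfl

theorem φ_eq (z : ℂ) : S.φ z = fun t => S.Y z t * (Matrix.fromRows 0 1 : Col2 n) := by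
  funext t
  conv_rhs => rw [← Matrix.fromCols_toCols (S.Y z t)]
  rw [Matrix.fromCols_mul_fromRows, Matrix.mul_one, Matrix.mul_zero, zero_add]
  rfl

theorem isSolution_ψ (z : ℂ) (l : Matrix (Fin n) (Fin n) ℂ) :
    S.IsSolution (fun t => z • S.A t + S.B t) (S.ψ z l) := by
  rw [ψ_eq]
  exact (S.isSolution_Y z).1.mul_const _

theorem isSolution_φ (z : ℂ) : S.IsSolution (fun t => z • S.A t + S.B t) (S.φ z) := by
  rw [φ_eq]
  exact (S.isSolution_Y z).1.mul_const _

theorem isSolution_ζ (z : ℂ) (l : Matrix (Fin n) (Fin n) ℂ) :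
    S.IsSolution (fun t => conj z • S.A t + (S.B t)ᴴ) (S.ζ z l) := by
  rw [ζ_eq]
  exact (S.isSolution_Z z).1.mul_const _

theorem hat_ψ (z : ℂ) (l : Matrix (Fin n) (Fin n) ℂ) (t : ℝ) :
    S.hat (S.ψ z l) t = S.hat (S.Y z) t * (Matrix.fromRows 1 l : Col2 n) := by
  rw [ψ_eq, hat_mul_const]

theorem hat_ζ (z : ℂ) (l : Matrix (Fin n) (Fin n) ℂ) (t : ℝ) :
    S.hat (S.ζ z l) t = S.hat (S.Z z) t * (Matrix.fromRows 1 lᴴ : Col2 n) := by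
  rw [ζ_eq, hat_mul_const]

theorem hat_φ (z : ℂ) (t : ℝ) : S.hat (S.φ z) t = (S.hat (S.Y z) t).toCols₂ := by
  rw [φ_eq, hat_mul_const]
  conv_lhs => rw [← Matrix.fromCols_toCols (S.hat (S.Y z) t)]
  rw [Matrix.fromCols_mul_fromRows, Matrix.mul_one, Matrix.mul_zero, zero_add]

theorem continuous_hat_ψ (z : ℂ) (t : ℝ) : Continuous fun l => S.hat (S.ψ z l) t := by
  simp only [hat_ψ]
  exact continuous_const.matrix_mul
    (continuous_fromRows.comp (continuous_const.prodMk continuous_id))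

theorem continuous_hat_ζ (z : ℂ) (t : ℝ) : Continuous fun l => S.hat (S.ζ z l) t := by
  simp only [hat_ζ]
  exact continuous_const.matrix_mul
    (continuous_fromRows.comp (continuous_const.prodMk continuous_id.matrix_conjTranspose))

/-- At equal parameters the pairing is constant, so `Ẑ* J Ŷ = J` throughout and `-J Ẑ* J` is a left
inverse. -/
theorem isUnit_hat_Y (z : ℂ) {t : ℝ} (ht : t ∈ S.T) : IsUnit (S.hat (S.Y z) t) := by
  have h1 := pairing_eq (S.isSolution_Y z).1 (S.isSolution_Z z).1 ht
  rw [(S.isSolution_Y z).2, (S.isSolution_Z z).2, conjTranspose_J, neg_mul, J_mul_J, neg_neg,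
    one_mul] at h1
  have h2 : -(J n * ((S.hat (S.Z z) t)ᴴ * J n)) * S.hat (S.Y z) t = 1 := by
    rw [neg_mul, mul_assoc, h1, J_mul_J, neg_neg]
  exact (Matrix.isUnit_iff_isUnit_det _).2 (Matrix.isUnit_det_of_left_inverse h2)

theorem hat_ψ_mulVec_eq_zero {z : ℂ} {l : Matrix (Fin n) (Fin n) ℂ} {t : ℝ} (ht : t ∈ S.T)
    {v : Fin n → ℂ} (hv : S.hat (S.ψ z l) t *ᵥ v = 0) : v = 0 := by
  have hdet := (Matrix.isUnit_iff_isUnit_det _).1 (S.isUnit_hat_Y z ht)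
  rw [hat_ψ, ← Matrix.mulVec_mulVec] at hv
  have h1 : (Matrix.fromRows 1 l : Col2 n) *ᵥ v = 0 := by
    have := congrArg ((S.hat (S.Y z) t)⁻¹ *ᵥ ·) hv
    simpa [Matrix.mulVec_mulVec, ← Matrix.mul_assoc, Matrix.nonsing_inv_mul _ hdet] using this
  rw [Matrix.fromRows_mulVec, Matrix.one_mulVec] at h1
  ext i
  exact congrFun h1 (Sum.inl i)

theorem pairing_start (z ξ : ℂ) (l l' : Matrix (Fin n) (Fin n) ℂ) :
    (S.hat (S.ζ ξ l') S.t₀)ᴴ * J n * S.hat (S.ψ z l) S.t₀ = l' - l := by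
  rw [hat_ψ, hat_ζ, (S.isSolution_Y z).2, (S.isSolution_Z ξ).2, Matrix.conjTranspose_mul,
    conjTranspose_J, Matrix.mul_neg, Matrix.neg_mul, Matrix.mul_assoc _ (J n) (J n), J_mul_J,
    Matrix.mul_neg, Matrix.mul_one, neg_neg, ← Matrix.mul_assoc, J, conjTranspose_fromRows_mul_mul]
  simp [sub_eq_neg_add]

theorem pairing_self (z : ℂ) (l : Matrix (Fin n) (Fin n) ℂ) {t : ℝ} (ht : t ∈ S.T) :
    (S.hat (S.ζ z l) t)ᴴ * J n * S.hat (S.ψ z l) t = 0 := by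
  rw [pairing_eq (S.isSolution_ψ z l) (S.isSolution_ζ z l) ht, pairing_start, sub_self]

/-! ### Positivity -/

variable {S} {z₀ z : ℂ} {U : Matrix (Fin n) (Fin n) ℂ}

theorem posSemidef_W_sub (hadm : S.Admissible z₀ U) {δ : ℝ} {t : ℝ} (ht : t ∈ S.T)
    (hδ : (rePart ((z - z₀) • (rot U * S.A t)) - δ • S.Atilde U t).PosSemidef) :
    (S.W U z t - δ • S.Atilde U t).PosSemidef := by
  have h1 : S.W U z t - δ • S.Atilde U t =
      S.W U z₀ t + (rePart ((z - z₀) • (rot U * S.A t)) - δ • S.Atilde U t) := by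
    rw [← add_sub_assoc, W, W, ← rePart_add]
    congr 2
    rw [← Matrix.mul_smul, ← Matrix.mul_add, sub_smul]
    congr 1
    abel
  rw [h1]
  exact (hadm.2 t ht).add hδ

theorem exists_posSemidef_sub (hadm : S.Admissible z₀ U) (hcomp : S.Comparable U)
    (hz : z ∈ S.Λ z₀ U) : ∃ δ : ℝ, 0 < δ ∧ ∀ t ∈ S.T,
      (rePart (rot U * (z • S.A t + S.B t)) - δ • S.A t).PosSemidef := by
  obtain ⟨δ, hδ, h1⟩ := hz
  obtain ⟨c, C, hc, -, h2⟩ := hcomp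
  refine ⟨δ * c, mul_pos hδ hc, fun t ht => ?_⟩
  have h3 := (posSemidef_W_sub hadm ht (h1 t ht)).add ((h2 t ht).1.smul hδ.le)
  rw [smul_sub, smul_smul, sub_add_sub_cancel] at h3
  exact h3

/-- Conjugating `W ≥ δ Ã` by the inverse rotation turns `Ã` back into `A` and `Re[U₂ₙ C]` into the
real part of the rotated adjoint coefficients. -/
theorem exists_posSemidef_adjoint_sub (hadm : S.Admissible z₀ U) (hz : z ∈ S.Λ z₀ U) :
    ∃ δ : ℝ, 0 < δ ∧ ∀ t ∈ S.T,
      (rePart (rot U⁻¹ * (conj z • S.A t + (S.B t)ᴴ)) - δ • S.A t).PosSemidef := by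
  obtain ⟨δ, hδ, h1⟩ := hz
  refine ⟨δ, hδ, fun t ht => ?_⟩
  have h3 := (posSemidef_W_sub hadm ht (h1 t ht)).mul_mul_conjTranspose_same (rot U⁻¹)
  have h4 := rot_mul_rot_inv hadm.1
  have h5 : (rot U)ᴴ * (rot U⁻¹)ᴴ = 1 := by
    rw [← Matrix.conjTranspose_mul, h4, Matrix.conjTranspose_one]
  have h6 : (conj z • S.A t + (S.B t)ᴴ) = (z • S.A t + S.B t)ᴴ := by
    rw [Matrix.conjTranspose_add, Matrix.conjTranspose_smul, (S.posSemidef_A ht).isHermitian.eq]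
    rfl
  convert h3 using 1
  rw [h6, W, Atilde, rePart, rePart]
  generalize z • S.A t + S.B t = C
  rw [Matrix.mul_sub, Matrix.sub_mul, Matrix.mul_smul, Matrix.smul_mul, Matrix.mul_smul,
    Matrix.smul_mul]
  congr 2
  · rw [Matrix.mul_add, Matrix.add_mul, add_comm]
    congr 1
    · rw [Matrix.conjTranspose_mul, Matrix.conjTranspose_conjTranspose, ← Matrix.mul_assoc, h4,
        Matrix.one_mul]
    · rw [Matrix.conjTranspose_mul, Matrix.mul_assoc, Matrix.mul_assoc, h5, Matrix.mul_one]
  · rw [← Matrix.mul_assoc, ← Matrix.mul_assoc, h4, Matrix.one_mul, Matrix.mul_assoc, h5,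
      Matrix.mul_one]

theorem posSemidef_of_sub {C : ℝ → Mat2 n} {δ : ℝ} (hδ : 0 < δ) {t : ℝ} (ht : t ∈ S.T)
    (h : (rePart (rot U * C t) - δ • S.A t).PosSemidef) : (rePart (rot U * C t)).PosSemidef := by
  have := h.add ((S.posSemidef_A ht).smul hδ.le)
  rwa [sub_add_cancel] at this

theorem form_mul_const {m : Type*} [Fintype m] (y : ℝ → Matrix (Fin n ⊕ Fin n) m ℂ)
    (N : Matrix m Unit ℂ) (t : ℝ) : S.form U (fun s => y s * N) () t =
      ((Nᴴ * ((S.hat y t)ᴴ * (rot U * J n) * S.hat y t) * N) () ()).re := by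
  rw [form, hat_mul_const, Matrix.conjTranspose_mul]
  simp only [Matrix.mul_assoc]

/-- The form `ŷ* U₂ₙ J ŷ` is nondecreasing. -/
theorem posSemidef_form_sub {m : Type*} [Fintype m] {C : ℝ → Mat2 n}
    {y : ℝ → Matrix (Fin n ⊕ Fin n) m ℂ} (hy : S.IsSolution C y) (hC : ContinuousOn C S.T)
    (hpos : ∀ t ∈ S.T, (rePart (rot U * C t)).PosSemidef) {a b : ℝ} (ha : a ∈ S.T)
    (hb : b ∈ S.T) (hab : a ≤ b) : ((S.hat y b)ᴴ * (rot U * J n) * S.hat y b -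
      (S.hat y a)ᴴ * (rot U * J n) * S.hat y a).PosSemidef := by
  have hH : ∀ t, ((S.hat y t)ᴴ * (rot U * J n) * S.hat y t).IsHermitian := fun t =>
    Matrix.isHermitian_conjTranspose_mul_mul _ (isHermitian_rot_mul_J U)
  refine posSemidef_of_forall_col ((hH b).sub (hH a)) fun N => ?_
  have := two_mul_integral_density_le (V := U) (δ := 0) (hy.mul_const N) hC
    (fun t ht => by simpa using hpos t ht) ha hb hab ()
  rw [form_mul_const, form_mul_const] at this
  rw [Matrix.mul_sub, Matrix.sub_mul, Matrix.sub_apply, Complex.sub_re]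
  simpa using this

theorem form_nonpos {m : Type*} [Fintype m] {y : ℝ → Matrix (Fin n ⊕ Fin n) m ℂ} {t : ℝ}
    (h : (-((S.hat y t)ᴴ * (rot U * J n) * S.hat y t)).PosSemidef) (j : m) :
    S.form U y j t ≤ 0 := by
  have h1 := h.diag_nonneg (i := j)
  rw [Complex.le_def, Matrix.neg_apply] at h1
  simpa [form] using h1.1

theorem D_antitone (hadm : S.Admissible z₀ U) (hcomp : S.Comparable U) (hz : z ∈ S.Λ z₀ U)
    {a b : ℝ} (ha : a ∈ S.T) (hb : b ∈ S.T) (hab : a ≤ b) : S.D U b z ⊆ S.D U a z := by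
  intro l hl
  obtain ⟨δ, hδ, hpos⟩ := exists_posSemidef_sub hadm hcomp hz
  have := Matrix.PosSemidef.add hl (posSemidef_form_sub (U := U) (S.isSolution_ψ z l)
    (S.continuousOn_coeff z)
    (fun t ht => posSemidef_of_sub (C := fun t => z • S.A t + S.B t) hδ ht (hpos t ht)) ha hb hab)
  rw [neg_add_eq_sub, sub_sub_cancel_left] at this
  exact this

theorem isClosed_D (U : Matrix (Fin n) (Fin n) ℂ) (t : ℝ) (z : ℂ) : IsClosed (S.D U t z) := by
  have h1 := S.continuous_hat_ψ z t
  exact isClosed_posSemidef.preimage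
    ((h1.matrix_conjTranspose.matrix_mul continuous_const).matrix_mul h1).neg

/-- If `ψ = θ + φ l` is nonpositive at `t`, then so is `ζ = η + χ l*` for the adjoint system. -/
theorem posSemidef_ζ (hadm : S.Admissible z₀ U) {l : Matrix (Fin n) (Fin n) ℂ} {t : ℝ}
    (ht : t ∈ S.T) (hl : l ∈ S.D U t z) :
    (-((S.hat (S.ζ z l) t)ᴴ * (rot U⁻¹ * J n) * S.hat (S.ζ z l) t)).PosSemidef :=
  posSemidef_dual hadm.1 (fun _ hv => S.hat_ψ_mulVec_eq_zero ht hv) hl (S.pairing_self z l ht)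

/-- The form of `φ` eventually is positive definite. -/
theorem exists_posDef_φ (hadm : S.Admissible z₀ U) (hdef : S.Definite z₀ U)
    (hcomp : S.Comparable U) (hz : z ∈ S.Λ z₀ U) :
    ∃ τ ∈ S.T, ((S.hat (S.φ z) τ)ᴴ * (rot U * J n) * S.hat (S.φ z) τ).PosDef := by
  have h := S.isSturmian
  obtain ⟨δ, hδ, hpos⟩ := exists_posSemidef_sub hadm hcomp hz
  have hW : ∀ t ∈ S.T, (S.W U z t).PosSemidef := fun t ht =>
    posSemidef_of_sub (C := fun t => z • S.A t + S.B t) hδ ht (hpos t ht)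
  have hmono := fun {a b : ℝ} => posSemidef_form_sub (a := a) (b := b) (U := U) (S.isSolution_φ z)
    (S.continuousOn_coeff z) hW
  have : Nonempty S.T := ⟨⟨S.t₀, h.start_mem⟩⟩
  have key := exists_posDef_of_directed (T := S.T)
    (fun t => (S.hat (S.φ z) t)ᴴ * (rot U * J n) * S.hat (S.φ z) t)
    (fun t => Matrix.isHermitian_conjTranspose_mul_mul _ (isHermitian_rot_mul_J U))
    (fun s t hst => hmono s.2 t.2 hst) ?_
  · obtain ⟨τ, hτ⟩ := key
    exact ⟨τ, τ.2, hτ⟩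
  intro x hx
  set N : Matrix (Fin n) Unit ℂ := Matrix.replicateCol Unit x with hN
  have hcol : ∀ (M : Matrix (Fin n) (Fin n) ℂ), (Nᴴ * M * N) () () = star x ⬝ᵥ M *ᵥ x := by
    intro M
    rw [Matrix.mul_assoc]
    rfl
  -- The initial value `(-1; 0)` is neutral for the off-diagonal form. So along `φ x` the form
  -- starts at zero and is nondecreasing; as it is also never positive, it vanishes identically.
  have hφ₀ : (S.hat (S.φ z) S.t₀)ᴴ * (rot U * J n) * S.hat (S.φ z) S.t₀ = 0 := by
    rw [φ_eq, hat_mul_const, (S.isSolution_Y z).2, rot_mul_J]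
    rw [show J n * (Matrix.fromRows 0 1 : Col2 n) = Matrix.fromRows (-1) 0 by
      rw [J, Matrix.fromBlocks_mul_fromRows]; simp]
    rw [conjTranspose_fromRows_mul_mul]
    simp
  have hsol := (S.isSolution_φ z).mul_const N
  have hzero : ∀ t ∈ S.T, S.form U (fun s => S.φ z s * N) () t = 0 := by
    intro t ht
    rw [form_mul_const, hcol]
    refine le_antisymm (hx ⟨t, ht⟩) ?_
    have := hmono h.start_mem ht ht.2
    rw [hφ₀, sub_zero] at this
    exact this.re_dotProduct_nonneg x
  -- The vanishing form has zero derivative, so `(φ x)* W (φ x) = 0`; since `W ≥ 0` this forces `W φ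
  -- x = 0`, and definiteness applies.
  refine hdef z hz x fun t ht => ?_
  have h1 := hasDeltaDeriv_re (hasDeltaDeriv_apply (hsol.hasDeltaDeriv_rot U ht) () ())
  have h2 : HasDeltaDeriv S.X S.t₀ (S.form U (fun s => S.φ z s * N) ()) 0 t := by
    refine h.hasDeltaDeriv_congr (f := fun _ => (0 : ℝ)) (fun s hs => (hzero s hs).symm) ht ?_
    simp only [HasDeltaDeriv, sub_self, smul_zero]
    exact tendsto_const_nhds
  have h3 := h.hasDeltaDeriv_unique ht h1 h2
  have h4 : star (S.φ z t *ᵥ x) ⬝ᵥ S.W U z t *ᵥ (S.φ z t *ᵥ x) = 0 := by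
    have h5 := (hW t ht).isHermitian.im_star_dotProduct_mulVec_self (S.φ z t *ᵥ x)
    refine Complex.ext ?_ h5
    have h6 : ((S.φ z t * N)ᴴ * S.W U z t * (S.φ z t * N)) () () =
        star (S.φ z t *ᵥ x) ⬝ᵥ S.W U z t *ᵥ (S.φ z t *ᵥ x) := by
      rw [Matrix.mul_assoc]
      rfl
    rw [← h6, W, rePart, Matrix.mul_smul, Matrix.smul_mul, Matrix.smul_apply, smul_eq_mul,
      show (1 / 2 : ℂ) = ((1 / 2 : ℝ) : ℂ) by norm_num, Complex.re_ofReal_mul, h3, mul_zero,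
      Complex.zero_re]
  rw [← Matrix.mulVec_mulVec]
  exact ((hW t ht).dotProduct_mulVec_zero_iff _).1 h4

/-- Choose `l` so that `ψ̂(t, z)` and `ψ̂(t, ξ)` have the same range. Nonpositivity is then
inherited, and both mixed pairings vanish at `t` because the unmixed ones do. -/
theorem exists_mem_D {ξ : ℂ} {M₀ : Matrix (Fin n) (Fin n) ℂ} {t : ℝ} (ht : t ∈ S.T)
    (hM₀ : M₀ ∈ S.D U t ξ)
    (hφ : ((S.hat (S.φ z) t)ᴴ * (rot U * J n) * S.hat (S.φ z) t).PosDef) :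
    ∃ l ∈ S.D U t z, (S.hat (S.ζ ξ M₀) t)ᴴ * J n * S.hat (S.ψ z l) t = 0 ∧
      (S.hat (S.ζ z l) t)ᴴ * J n * S.hat (S.ψ ξ M₀) t = 0 := by
  rw [hat_φ] at hφ
  obtain ⟨l, α, hα, h1⟩ := exists_mul_fromRows_eq (S.isUnit_hat_Y z ht)
    (fun v hv => S.hat_ψ_mulVec_eq_zero ht hv) hM₀ hφ
  have hdet := (Matrix.isUnit_iff_isUnit_det _).1 hα
  rw [← hat_ψ] at h1
  have h2 : S.hat (S.ψ z l) t = S.hat (S.ψ ξ M₀) t * α⁻¹ := by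
    rw [← h1, Matrix.mul_assoc, Matrix.mul_nonsing_inv _ hdet, Matrix.mul_one]
  refine ⟨l, ?_, ?_, ?_⟩
  · have h3 := Matrix.PosSemidef.conjTranspose_mul_mul_same hM₀ α⁻¹
    rw [D, Set.mem_ofPred_eq, h2]
    convert h3 using 1
    simp only [Matrix.conjTranspose_mul, Matrix.mul_neg, Matrix.neg_mul, Matrix.mul_assoc]
  · rw [h2, ← Matrix.mul_assoc, S.pairing_self ξ M₀ ht, Matrix.zero_mul]
  · rw [← h1, ← Matrix.mul_assoc, S.pairing_self z l ht, Matrix.zero_mul]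

end HamiltonianSystem


namespace HamiltonianSystem

variable {n : ℕ} {S : HamiltonianSystem n}

/-! ### Limits at infinity -/

theorem integral_density_le_tail {m : Type*} {y : ℝ → Matrix (Fin n ⊕ Fin n) m ℂ}
    (hy : ContinuousOn y S.T) {j : m}
    (hi : IntegrableOn (fun x => S.density y j (retract S.X S.t₀ x)) (Set.Ioi S.t₀)) {a b : ℝ}
    (ha : a ∈ S.T) (hb : b ∈ S.T) : ∫ x in a..b, S.density y j (retract S.X S.t₀ x) ≤
      (∫ x in Set.Ioi S.t₀, S.density y j (retract S.X S.t₀ x)) -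
        ∫ x in S.t₀..a, S.density y j (retract S.X S.t₀ x) := by
  have h := S.isSturmian
  have hc := continuousOn_density hy j
  rw [← intervalIntegral.integral_interval_sub_left (h.intervalIntegrable hc le_rfl hb.2)
    (h.intervalIntegrable hc le_rfl ha.2)]
  refine sub_le_sub_right ?_ _
  rw [intervalIntegral.integral_of_le hb.2]
  refine setIntegral_mono_set hi ?_ (LE.le.eventuallyLE Set.Ioc_subset_Ioi_self)
  filter_upwards [ae_restrict_mem measurableSet_Ioi] with x hx
  exact density_nonneg (h.retract_mem (le_of_lt (Set.mem_Ioi.1 hx))) y j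

theorem tendsto_tail {g : ℝ → ℝ} (hi : IntegrableOn g (Set.Ioi S.t₀)) :
    Tendsto (fun a => (∫ x in Set.Ioi S.t₀, g x) - ∫ x in S.t₀..a, g x) S.toInfty (𝓝 0) := by
  have := (intervalIntegral_tendsto_integral_Ioi S.t₀ hi S.tendsto_toInfty).const_sub
    (∫ x in Set.Ioi S.t₀, g x)
  rwa [sub_self] at this

/-- Only the sign of the form at the upper end is needed, so the bound serves for approximants that
lie in `D(b, λ)` but perhaps not in `D(∞, λ)`. -/
theorem integral_density_le {m : Type*} {C : ℝ → Mat2 n} {y : ℝ → Matrix (Fin n ⊕ Fin n) m ℂ}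
    (hy : S.IsSolution C y) (hC : ContinuousOn C S.T) {V : Matrix (Fin n) (Fin n) ℂ} {δ : ℝ}
    (hδ : 0 < δ) (hpos : ∀ t ∈ S.T, (rePart (rot V * C t) - δ • S.A t).PosSemidef) {j : m}
    {a b : ℝ} (ha : a ∈ S.T) (hb : b ∈ S.T) (hneg : S.form V y j b ≤ 0) :
    ∫ x in a..b, S.density y j (retract S.X S.t₀ x) ≤ -S.form V y j S.t₀ / (2 * δ) := by
  have h := S.isSturmian
  have hc := continuousOn_density hy.continuousOn j
  rw [← intervalIntegral.integral_interval_sub_left (h.intervalIntegrable hc le_rfl hb.2)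
    (h.intervalIntegrable hc le_rfl ha.2)]
  have h1 := two_mul_integral_density_le hy hC hpos h.start_mem hb hb.2 j
  have h2 : 0 ≤ ∫ x in S.t₀..a, S.density y j (retract S.X S.t₀ x) :=
    intervalIntegral.integral_nonneg ha.2 fun x hx => density_nonneg (h.retract_mem hx.1) y j
  have h3 : ∫ x in S.t₀..b, S.density y j (retract S.X S.t₀ x) ≤
      -S.form V y j S.t₀ / (2 * δ) := by
    rw [le_div_iff₀' (by positivity)]
    linarith
  linarith

theorem tendsto_zero_of_forall_le {f : Filter ℝ} [f.NeBot] {G : ℝ → ℂ} {Gf : ℝ → ℝ → ℂ}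
    {α c : ℝ → ℝ} {c₀ : ℝ} (hG : ∀ t ∈ S.T, Tendsto (fun τ => Gf τ t) f (𝓝 (G t)))
    (hc : Tendsto c f (𝓝 c₀)) (hα : Tendsto α S.toInfty (𝓝 0))
    (hb : ∀ t ∈ S.T, ∀ κ > 0, ∀ᶠ τ in f, ‖Gf τ t‖ ≤ κ * α t + κ⁻¹ * c τ) :
    Tendsto G S.toInfty (𝓝 0) := by
  have h1 : ∀ t ∈ S.T, ∀ κ > 0, ‖G t‖ ≤ κ * α t + κ⁻¹ * c₀ := fun t ht κ hκ =>
    le_of_tendsto_of_tendsto (hG t ht).norm ((hc.const_mul _).const_add _) (hb t ht κ hκ)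
  rw [Metric.tendsto_nhds]
  intro ε hε
  -- Large enough that `κ⁻¹ c₀ < ε / 2`; with `κ` now fixed, `κ α t` is small for late `t`.
  set κ := 2 * |c₀| / ε + 1 with hκ
  have hκ0 : 0 < κ := by positivity
  have h2 : κ⁻¹ * c₀ < ε / 2 := by
    rw [inv_mul_lt_iff₀ hκ0, hκ]
    have : (2 * |c₀| / ε + 1) * (ε / 2) = |c₀| + ε / 2 := by field_simp
    rw [this]
    linarith [le_abs_self c₀]
  have h3 : ∀ᶠ t in S.toInfty, κ * α t < ε / 2 := by
    have := hα.const_mul κ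
    rw [mul_zero] at this
    exact this.eventually (gt_mem_nhds (half_pos hε))
  filter_upwards [h3, S.eventually_mem_toInfty] with t h4 ht
  rw [dist_zero_right]
  linarith [h1 t ht κ hκ0]

theorem isCompact_forall_norm_le (C : ℝ) :
    IsCompact {l : Matrix (Fin n) (Fin n) ℂ | ∀ i j, ‖l i j‖ ≤ C} := by
  have h1 : IsCompact (Set.univ.pi fun _ : Fin n => Set.univ.pi fun _ : Fin n =>
      Metric.closedBall (0 : ℂ) C) :=
    isCompact_univ_pi fun _ => isCompact_univ_pi fun _ => isCompact_closedBall _ _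
  have h2 : (Set.univ.pi fun _ : Fin n => Set.univ.pi fun _ : Fin n =>
      Metric.closedBall (0 : ℂ) C) = {l : Fin n → Fin n → ℂ | ∀ i j, ‖l i j‖ ≤ C} := by
    ext l
    simp only [Set.mem_univ_pi, mem_closedBall_zero_iff, Set.mem_ofPred_eq]
  rw [h2] at h1
  exact h1

variable {z₀ z ξ : ℂ} {U M₀ : Matrix (Fin n) (Fin n) ℂ}

theorem mem_D_of_mem_DInfty {l : Matrix (Fin n) (Fin n) ℂ} (hl : l ∈ S.DInfty U z) {t : ℝ}
    (ht : t ∈ S.T) : l ∈ S.D U t z :=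
  Set.mem_iInter₂.1 hl t ht

theorem integrableOn_density_ψ (hadm : S.Admissible z₀ U) (hcomp : S.Comparable U)
    (hz : z ∈ S.Λ z₀ U) {l : Matrix (Fin n) (Fin n) ℂ} (hl : l ∈ S.DInfty U z) (j : Fin n) :
    IntegrableOn (fun x => S.density (S.ψ z l) j (retract S.X S.t₀ x)) (Set.Ioi S.t₀) := by
  obtain ⟨δ, hδ, hpos⟩ := exists_posSemidef_sub hadm hcomp hz
  exact integrableOn_density (S.isSolution_ψ z l) (S.continuousOn_coeff z) hδ hpos j
    fun t ht => form_nonpos (mem_D_of_mem_DInfty hl ht) j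

theorem integrableOn_density_ζ (hadm : S.Admissible z₀ U) (hz : z ∈ S.Λ z₀ U)
    {l : Matrix (Fin n) (Fin n) ℂ} (hl : l ∈ S.DInfty U z) (i : Fin n) :
    IntegrableOn (fun x => S.density (S.ζ z l) i (retract S.X S.t₀ x)) (Set.Ioi S.t₀) := by
  obtain ⟨δ, hδ, hpos⟩ := exists_posSemidef_adjoint_sub hadm hz
  exact integrableOn_density (S.isSolution_ζ z l) (S.continuousOn_adjoint_coeff z) hδ hpos i
    fun t ht => form_nonpos (posSemidef_ζ hadm ht (mem_D_of_mem_DInfty hl ht)) i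

theorem continuous_form {m : Type*} {y : Matrix (Fin n) (Fin n) ℂ → ℝ → Matrix (Fin n ⊕ Fin n) m ℂ}
    {t : ℝ} (hy : Continuous fun l => S.hat (y l) t) (V : Matrix (Fin n) (Fin n) ℂ) (j : m) :
    Continuous fun l => S.form V (y l) j t :=
  Complex.continuous_re.comp
    (((hy.matrix_conjTranspose.matrix_mul continuous_const).matrix_mul hy).matrix_elem j j)

/-- Existence of a value of the `M`-function. -/
theorem exists_mem_DInfty (hadm : S.Admissible z₀ U) (hdef : S.Definite z₀ U)
    (hcomp : S.Comparable U) (hξ : ξ ∈ S.Λ z₀ U) (hM₀ : M₀ ∈ S.DInfty U ξ) (hz : z ∈ S.Λ z₀ U) :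
    ∃ M ∈ S.DInfty U z,
      Tendsto (fun t => (S.hat (S.ζ ξ M₀) t)ᴴ * J n * S.hat (S.ψ z M) t) S.toInfty (𝓝 0) ∧
      Tendsto (fun t => (S.hat (S.ζ z M) t)ᴴ * J n * S.hat (S.ψ ξ M₀) t) S.toInfty (𝓝 0) := by
  obtain ⟨τ₀, hτ₀, hφ₀⟩ := exists_posDef_φ hadm hdef hcomp hz
  obtain ⟨δ, hδ, hpos⟩ := exists_posSemidef_sub hadm hcomp hz
  obtain ⟨δ', hδ', hpos'⟩ := exists_posSemidef_adjoint_sub hadm hz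
  have hφ : ∀ τ ∈ S.T, τ₀ ≤ τ →
      ((S.hat (S.φ z) τ)ᴴ * (rot U * J n) * S.hat (S.φ z) τ).PosDef := by
    intro τ hτ hle
    have := hφ₀.add_posSemidef (posSemidef_form_sub (U := U) (S.isSolution_φ z)
      (S.continuousOn_coeff z) (fun t ht => posSemidef_of_sub
        (C := fun t => z • S.A t + S.B t) hδ ht (hpos t ht)) hτ₀ hτ hle)
    rwa [add_sub_cancel] at this
  have hex : ∀ τ, ∃ l, τ ∈ S.T → τ₀ ≤ τ → l ∈ S.D U τ z ∧
      (S.hat (S.ζ ξ M₀) τ)ᴴ * J n * S.hat (S.ψ z l) τ = 0 ∧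
      (S.hat (S.ζ z l) τ)ᴴ * J n * S.hat (S.ψ ξ M₀) τ = 0 := by
    intro τ
    by_cases hτ : τ ∈ S.T ∧ τ₀ ≤ τ
    · obtain ⟨l, h1, h2⟩ := exists_mem_D hτ.1 (mem_D_of_mem_DInfty hM₀ hτ.1) (hφ τ hτ.1 hτ.2)
      exact ⟨l, fun _ _ => ⟨h1, h2⟩⟩
    · exact ⟨0, fun h1 h2 => absurd ⟨h1, h2⟩ hτ⟩
  choose l hl using hex
  obtain ⟨C, hC⟩ := exists_bound_of_posDef
    (G := (S.hat (S.Y z) τ₀)ᴴ * (rot U * J n) * S.hat (S.Y z) τ₀) (by rwa [hat_φ] at hφ₀)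
  -- An ultrafilter at infinity replaces the extraction of a convergent subsequence: the bounded
  -- family `l` converges along it to a single `M` that serves all assertions.
  set f : Ultrafilter ℝ := Ultrafilter.of S.toInfty with hf
  have hfle : (f : Filter ℝ) ≤ S.toInfty := Ultrafilter.of_le _
  have hgood : ∀ t, ∀ᶠ τ in (f : Filter ℝ), τ ∈ S.T ∧ τ₀ ≤ τ ∧ t ≤ τ := fun t =>
    hfle (S.eventually_mem_toInfty.and
      ((S.eventually_ge_toInfty τ₀).and (S.eventually_ge_toInfty t)))
  have hbdd : ((f.map l : Ultrafilter _) : Filter (Matrix (Fin n) (Fin n) ℂ)) ≤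
      𝓟 {l | ∀ i j, ‖l i j‖ ≤ C} := by
    rw [Ultrafilter.coe_map, le_principal_iff, Filter.mem_map]
    filter_upwards [hgood τ₀] with τ hτ
    refine hC _ ?_
    have h1 := D_antitone hadm hcomp hz hτ₀ hτ.1 hτ.2.1 (hl τ hτ.1 hτ.2.1).1
    rw [D, Set.mem_ofPred_eq, hat_ψ, Matrix.conjTranspose_mul] at h1
    simpa only [Matrix.mul_assoc] using h1
  obtain ⟨M, -, hM⟩ := (isCompact_forall_norm_le C).ultrafilter_le_nhds _ hbdd
  have hlM : Tendsto l f (𝓝 M) := hM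
  refine ⟨M, Set.mem_iInter₂.2 fun t ht => ?_, ?_, ?_⟩
  · refine (isClosed_D U t z).mem_of_tendsto hlM ?_
    filter_upwards [hgood t] with τ hτ
    exact D_antitone hadm hcomp hz ht hτ.1 hτ.2.2 (hl τ hτ.1 hτ.2.1).1
  · refine tendsto_pi_nhds.2 fun i => tendsto_pi_nhds.2 fun j => ?_
    have hi := integrableOn_density_ζ hadm hξ hM₀ i
    refine tendsto_zero_of_forall_le (f := f)
      (Gf := fun τ t => ((S.hat (S.ζ ξ M₀) t)ᴴ * J n * S.hat (S.ψ z (l τ)) t) i j)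
      (c := fun τ => ‖z - ξ‖ / 2 * (-S.form U (S.ψ z (l τ)) j S.t₀ / (2 * δ)))
      (c₀ := ‖z - ξ‖ / 2 * (-S.form U (S.ψ z M) j S.t₀ / (2 * δ)))
      (fun t ht => ?_) ?_ (by simpa using (tendsto_tail hi).const_mul (‖z - ξ‖ / 2)) ?_
    · exact (((continuous_const.matrix_mul (S.continuous_hat_ψ z t)).matrix_elem i j).tendsto
        M).comp hlM
    · exact ((((continuous_form (S.continuous_hat_ψ z S.t₀) U j).neg.div_const _).tendsto
        M).comp hlM).const_mul _
    · intro t ht κ hκ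
      filter_upwards [hgood t] with τ hτ
      have h0 := hl τ hτ.1 hτ.2.1
      have h1 := norm_pairing_sub_le (S.isSolution_ψ z (l τ)) (S.isSolution_ζ ξ M₀) ht hτ.1
        hτ.2.2 i j hκ
      have h2 := integral_density_le_tail (S.isSolution_ζ ξ M₀).continuousOn hi ht hτ.1
      have h3 := integral_density_le (S.isSolution_ψ z (l τ)) (S.continuousOn_coeff z) hδ hpos
        (j := j) ht hτ.1 (form_nonpos h0.1 j)
      rw [h0.2.1, Matrix.zero_apply, zero_sub, norm_neg] at h1
      refine h1.trans ?_
      have h4 := mul_le_mul_of_nonneg_left (add_le_add (mul_le_mul_of_nonneg_left h2 hκ.le)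
        (mul_le_mul_of_nonneg_left h3 (inv_pos.2 hκ).le))
        (div_nonneg (norm_nonneg (z - ξ)) zero_le_two)
      linarith
  · refine tendsto_pi_nhds.2 fun i => tendsto_pi_nhds.2 fun j => ?_
    have hi := integrableOn_density_ψ hadm hcomp hξ hM₀ j
    refine tendsto_zero_of_forall_le (f := f)
      (Gf := fun τ t => ((S.hat (S.ζ z (l τ)) t)ᴴ * J n * S.hat (S.ψ ξ M₀) t) i j)
      (c := fun τ => ‖ξ - z‖ / 2 * (-S.form U⁻¹ (S.ζ z (l τ)) i S.t₀ / (2 * δ')))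
      (c₀ := ‖ξ - z‖ / 2 * (-S.form U⁻¹ (S.ζ z M) i S.t₀ / (2 * δ')))
      (fun t ht => ?_) ?_ (by simpa using (tendsto_tail hi).const_mul (‖ξ - z‖ / 2)) ?_
    · exact ((((S.continuous_hat_ζ z t).matrix_conjTranspose.matrix_mul
        continuous_const).matrix_mul continuous_const).matrix_elem i j |>.tendsto M).comp hlM
    · exact ((((continuous_form (S.continuous_hat_ζ z S.t₀) U⁻¹ i).neg.div_const _).tendsto
        M).comp hlM).const_mul _
    · intro t ht κ hκ
      filter_upwards [hgood t] with τ hτ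
      have h0 := hl τ hτ.1 hτ.2.1
      -- The fixed solution with the small tail is now `ψ`, not `ζ`; using `κ⁻¹` puts the weight `κ`
      -- on that tail again.
      have h1 := norm_pairing_sub_le (S.isSolution_ψ ξ M₀) (S.isSolution_ζ z (l τ)) ht hτ.1
        hτ.2.2 i j (inv_pos.2 hκ)
      have h2 := integral_density_le_tail (S.isSolution_ψ ξ M₀).continuousOn hi ht hτ.1
      have h3 := integral_density_le (S.isSolution_ζ z (l τ)) (S.continuousOn_adjoint_coeff z)
        hδ' hpos' (j := i) ht hτ.1 (form_nonpos (posSemidef_ζ hadm hτ.1 h0.1) i)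
      rw [h0.2.2, Matrix.zero_apply, zero_sub, norm_neg, inv_inv] at h1
      refine h1.trans ?_
      have h4 := mul_le_mul_of_nonneg_left (add_le_add (mul_le_mul_of_nonneg_left h2 hκ.le)
        (mul_le_mul_of_nonneg_left h3 (inv_pos.2 hκ).le))
        (div_nonneg (norm_nonneg (ξ - z)) zero_le_two)
      linarith

end HamiltonianSystem

end WeylSims

/-! ### The `M`-function -/

theorem mainTheorem5 (n : ℕ) (S : WeylSims.HamiltonianSystem n)
    (z₀ : ℂ) (U : Matrix (Fin n) (Fin n) ℂ)
    (hadm : S.Admissible z₀ U) (hdef : S.Definite z₀ U) (hcomp : S.Comparable U)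
    (ξ : ℂ) (hξ : ξ ∈ S.Λ z₀ U)
    (M₀ : Matrix (Fin n) (Fin n) ℂ) (hM₀ : M₀ ∈ S.DInfty U ξ) :
    ∃ M : S.Λ z₀ U → Matrix (Fin n) (Fin n) ℂ,
      M ⟨ξ, hξ⟩ = M₀ ∧
      ∀ z : S.Λ z₀ U,
        M z ∈ S.DInfty U z ∧
        (∃ I₁ I₂ : Matrix (Fin n) (Fin n) ℂ,
          S.HasDeltaIntegral (fun t => (S.ζ ξ M₀ t)ᴴ * S.A t * S.ψ z (M z) t) I₁ ∧
          S.HasDeltaIntegral (fun t => (S.ζ z (M z) t)ᴴ * S.A t * S.ψ ξ M₀ t) I₂ ∧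
          M z - M₀ = ((z : ℂ) - ξ) • I₁ ∧
          M z - M₀ = ((z : ℂ) - ξ) • I₂) ∧
        Tendsto (fun t => (S.hat (S.ζ ξ M₀) t)ᴴ * WeylSims.J n * S.hat (S.ψ z (M z)) t)
          S.toInfty (𝓝 0) ∧
        Tendsto (fun t => (S.hat (S.ζ z (M z)) t)ᴴ * WeylSims.J n * S.hat (S.ψ ξ M₀) t)
          S.toInfty (𝓝 0) := by
  choose M hM h₁ h₂ using fun z : S.Λ z₀ U =>
    WeylSims.HamiltonianSystem.exists_mem_DInfty hadm hdef hcomp hξ hM₀ z.2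
  have key : ∀ z : S.Λ z₀ U, ∃ I₁ I₂ : Matrix (Fin n) (Fin n) ℂ,
      S.HasDeltaIntegral (fun t => (S.ζ ξ M₀ t)ᴴ * S.A t * S.ψ z (M z) t) I₁ ∧
      S.HasDeltaIntegral (fun t => (S.ζ z (M z) t)ᴴ * S.A t * S.ψ ξ M₀ t) I₂ ∧
      M z - M₀ = ((z : ℂ) - ξ) • I₁ ∧ M z - M₀ = ((z : ℂ) - ξ) • I₂ := by
    intro z
    obtain ⟨I₁, hI₁, he₁⟩ := WeylSims.HamiltonianSystem.hasDeltaIntegral_of_tendsto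
      (S.isSolution_ψ z (M z)) (S.isSolution_ζ ξ M₀)
      (WeylSims.HamiltonianSystem.integrableOn_density_ψ hadm hcomp z.2 (hM z))
      (WeylSims.HamiltonianSystem.integrableOn_density_ζ hadm hξ hM₀) (h₁ z)
    obtain ⟨I₂, hI₂, he₂⟩ := WeylSims.HamiltonianSystem.hasDeltaIntegral_of_tendsto
      (S.isSolution_ψ ξ M₀) (S.isSolution_ζ z (M z))
      (WeylSims.HamiltonianSystem.integrableOn_density_ψ hadm hcomp hξ hM₀)
      (WeylSims.HamiltonianSystem.integrableOn_density_ζ hadm z.2 (hM z)) (h₂ z)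
    rw [S.pairing_start, neg_sub] at he₁
    rw [S.pairing_start] at he₂
    refine ⟨I₁, I₂, hI₁, hI₂, he₁, ?_⟩
    rw [← neg_sub ξ, neg_smul, ← he₂, neg_neg]
  refine ⟨M, ?_, fun z => ⟨hM z, key z, h₁ z, h₂ z⟩⟩
  -- The value at `ξ` was not prescribed in the choice of `M`; the factor `z - ξ` in the integral
  -- formula forces it to be `M₀`.
  obtain ⟨I₁, -, -, -, he, -⟩ := key ⟨ξ, hξ⟩
  rw [sub_self, zero_smul] at he
  exact sub_eq_zero.1 he
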